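/- Let $\mathbb K=\mathbb R$ or $\mathbb C$ and let $\mathbb P^n$ be the projective space of lines in $\mathbb K^{n+1}$, regarded as a real algebraic manifold. "Semialgebraic" is meant in the real sense and "smooth" means $C^1$ (over $\mathbb R$). A *stratification* of a semialgebraic set $X\subset\mathbb P^n$ is a partition of $X$ into nonempty smooth semialgebraic submanifolds of $\mathbb P^n$ (the strata), locally finite in $\mathbb P^n$ (hence finite). If $\mathcal S$ is a stratification of $X$ and $\mathcal T$ a stratification of a semialgebraic subset $Y\subset X$, then $(Y,\mathcal T)$ is a *substratified object* of $(X,\mathcal S)$ if each stratum of $\mathcal T$ is contained in a stratum of $\mathcal S$. Two substratified objects $(Z,\mathcal A)$, $(W,\mathcal B)$ of $(X,\mathcal S)$ are *transverse in* $(X,\mathcal S)$ if for all $S\in\mathcal S$, $A\in\mathcal A$, $B\in\mathcal B$ with $A,B\subset S$, the manifolds $A$ and $B$ are transverse in $S$: $T_xA+T_xB=T_xS$ for all $x\in A\cap B$. Let $\mathcal S$ be a stratification of $\mathbb P^n$, let $U\subset\mathbb K^{n+1}$ be open and semialgebraic, and let $\Psi:U\times\mathbb P^n\to\mathbb P^n$,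 $\Psi_t(x)=\Psi^x(t)=\Psi(t,x)$, be a semialgebraic stratified submersive family of diffeomorphisms; that is, for every stratum $S\in\mathcal S$ the map $\Psi$ restricts to a smooth map $U\times S\to S$ such that each $\Psi_t:S\to S$ is a diffeomorphism and, for all $(t,x)\in U\times S$, the differential of $\Psi^x:U\to S$ at $t$ is surjective onto $T_{\Psi(t,x)}S$. (For instance, $\mathcal S$ may be an algebraic stratification of $\mathbb P^n$ compatible with a given finite family of algebraic subsets, and $\Psi$ a semialgebraic stratified submersive family of diffeomorphisms parametrized by a neighborhood $U$ of the origin, with $\Psi_0=\mathrm{id}$, that is in addition an arc-wise analytic trivialization.) Let $Z$ and $W$ be semialgebraic subsets of $\mathbb P^n$ with stratifications $\mathcal A$ of $Z$ and $\mathcal B$ of $W$ such that $(Z,\mathcal A)$ and $(W,\mathcal B)$ are substratified objects of $(\mathbb P^n,\mathcal S)$. Then there is an open dense semialgebraic subset $U'$ of $U$ such that for all $t\in U'$ the pair $\Psi_t^{-1}(W,\mathcal B)=(\Psi_t^{-1}(W),\{\Psi_t^{-1}(B): B\in\mathcal B\})$ is a substratified object of $(\mathbb P^n,\mathcal S)$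 and $(Z,\mathcal A)$ is transverse to $\Psi_t^{-1}(W,\mathcal B)$ in $(\mathbb P^n,\mathcal S)$. -/

import Mathlib

open Set Filter Topology

noncomputable section

/-! ### Semialgebraic sets, submanifolds and tangent spaces in a real vector space -/

section Euclidean

variable {E : Type*} [NormedAddCommGroup E] [NormedSpace ℝ E]

/-- The real polynomial functions on `E`: the algebra of functions generated by the
linear forms. -/
def realPolyFunctions (E : Type*) [NormedAddCommGroup E] [NormedSpace ℝ E] :
    Subalgebra ℝ (E → ℝ) :=
  Algebra.adjoin ℝ (Set.range fun (l : E →ₗ[ℝ] ℝ) => (l : E → ℝ))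

/-- The semialgebraic subsets of `E`: the smallest Boolean algebra of subsets containing all
`{p > 0}` with `p` a polynomial function. -/
inductive IsSemialgebraic : Set E → Prop
  | pos (p : E → ℝ) (hp : p ∈ realPolyFunctions E) : IsSemialgebraic {x | 0 < p x}
  | compl (s : Set E) (hs : IsSemialgebraic s) : IsSemialgebraic sᶜ
  | union (s t : Set E) (hs : IsSemialgebraic s) (ht : IsSemialgebraic t) :
      IsSemialgebraic (s ∪ t)

/-- `M` is an (embedded) `C¹` submanifold of `E` of some dimension `d`: near each of its
points it is the zero set of a `C¹` map to `ℝᵏ`, `k = dim E - d`, with surjective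
differential. -/
def IsC1Submanifold (M : Set E) : Prop :=
  ∃ d k : ℕ, d + k = Module.finrank ℝ E ∧
    ∀ p ∈ M, ∃ f : E → (Fin k → ℝ),
      ContDiffAt ℝ 1 f p ∧ Function.Surjective (fderiv ℝ f p) ∧
        ∀ᶠ q in 𝓝 p, (q ∈ M ↔ f q = 0)

/-- The tangent space of `M` at `p`: the velocities at `p` of curves in `M`. -/
def tangentVectors (M : Set E) (p : E) : Set E :=
  {v | ∃ γ : ℝ → E, γ 0 = p ∧ HasDerivAt γ v 0 ∧ ∀ᶠ s in 𝓝 (0 : ℝ), γ s ∈ M}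

end Euclidean

/-! ### Projective space as a real algebraic set -/

/-- The projective space `ℙⁿ` over `𝕜` (`𝕜 = ℝ` or `ℂ`). -/
abbrev ProjSpace (𝕜 : Type*) [RCLike 𝕜] (n : ℕ) : Type _ :=
  Projectivization 𝕜 (Fin (n + 1) → 𝕜)

/-- The real vector space of `(n+1) × (n+1)` matrices over `𝕜`. -/
abbrev MatSpace (𝕜 : Type*) [RCLike 𝕜] (n : ℕ) : Type _ :=
  Fin (n + 1) → Fin (n + 1) → 𝕜

section Projective

variable {𝕜 : Type*} [RCLike 𝕜] {n : ℕ}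

/-- The matrix `v v* / |v|²` of the orthogonal projection onto the line spanned by `v`. -/
def lineMatrix (v : Fin (n + 1) → 𝕜) : MatSpace 𝕜 n :=
  fun i j => v i * (starRingEnd 𝕜) (v j) / (((∑ k, ‖v k‖ ^ 2 : ℝ)) : 𝕜)

theorem sum_norm_sq_pos {v : Fin (n + 1) → 𝕜} (hv : v ≠ 0) : 0 < ∑ k, ‖v k‖ ^ 2 := by
  obtain ⟨k, hk⟩ := Function.ne_iff.1 hv
  exact Finset.sum_pos' (fun _ _ => by positivity)
    ⟨k, Finset.mem_univ k, by have := norm_pos_iff.2 hk; positivity⟩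

theorem lineMatrix_smul (a : 𝕜) (ha : a ≠ 0) (v : Fin (n + 1) → 𝕜) :
    lineMatrix (a • v) = lineMatrix v := by
  funext i j
  have h : ((∑ k, ‖(a • v) k‖ ^ 2 : ℝ) : 𝕜)
      = (a * (starRingEnd 𝕜) a) * ((∑ k, ‖v k‖ ^ 2 : ℝ) : 𝕜) := by
    rw [RCLike.mul_conj]
    simp only [Pi.smul_apply, smul_eq_mul, norm_mul, mul_pow, ← Finset.mul_sum]
    push_cast
    rfl
  have ha' : a * (starRingEnd 𝕜) a ≠ 0 := mul_ne_zero ha (by simpa using ha)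
  unfold lineMatrix
  rw [h, ← mul_div_mul_left (v i * (starRingEnd 𝕜) (v j)) _ ha']
  simp only [Pi.smul_apply, smul_eq_mul, map_mul]
  ring

/-- The standard embedding of `ℙⁿ` as a compact nonsingular real algebraic set: a line is sent
to the matrix of the orthogonal projection onto it. It is a real analytic, semialgebraic
diffeomorphism from `ℙⁿ` onto the set of Hermitian idempotent matrices of trace one. The real
algebraic and differentiable structure of `ℙⁿ` (semialgebraic subsets, submanifolds, tangent
spaces, `C¹` maps) is expressed through it. -/
def projEmb (x : ProjSpace 𝕜 n) : MatSpace 𝕜 n :=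
  Projectivization.lift (fun v : {v : Fin (n + 1) → 𝕜 // v ≠ 0} => lineMatrix v.1)
    (by
      rintro ⟨v, hv⟩ ⟨w, hw⟩ t h
      have ht : t ≠ 0 := by
        rintro rfl
        exact hv (by simpa using h)
      simp only at h
      simp only [h]
      exact lineMatrix_smul t ht w) x

theorem projEmb_mk (v : Fin (n + 1) → 𝕜) (hv : v ≠ 0) :
    projEmb (Projectivization.mk 𝕜 v hv) = lineMatrix v := rfl

theorem projEmb_injective : Function.Injective (projEmb : ProjSpace 𝕜 n → MatSpace 𝕜 n) := by
  intro x y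
  induction x using Projectivization.ind with
  | h v hv =>
  induction y using Projectivization.ind with
  | h w hw =>
  intro h
  rw [projEmb_mk, projEmb_mk] at h
  rw [Projectivization.mk_eq_mk_iff']
  obtain ⟨j, hj⟩ := Function.ne_iff.1 hv
  have hv0 : ((∑ k, ‖v k‖ ^ 2 : ℝ) : 𝕜) ≠ 0 := by exact_mod_cast (sum_norm_sq_pos hv).ne'
  have hj' : (starRingEnd 𝕜) (v j) ≠ 0 := by simpa using hj
  refine ⟨((starRingEnd 𝕜) (w j) / ((∑ k, ‖w k‖ ^ 2 : ℝ) : 𝕜)) *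
    (((∑ k, ‖v k‖ ^ 2 : ℝ) : 𝕜) / (starRingEnd 𝕜) (v j)), ?_⟩
  funext i
  have hij : v i * (starRingEnd 𝕜) (v j) / ((∑ k, ‖v k‖ ^ 2 : ℝ) : 𝕜)
      = w i * (starRingEnd 𝕜) (w j) / ((∑ k, ‖w k‖ ^ 2 : ℝ) : 𝕜) := congrFun (congrFun h i) j
  rw [div_eq_iff hv0] at hij
  have : v i = w i * (starRingEnd 𝕜) (w j) / ((∑ k, ‖w k‖ ^ 2 : ℝ) : 𝕜)
      * ((∑ k, ‖v k‖ ^ 2 : ℝ) : 𝕜) / (starRingEnd 𝕜) (v j) := by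
    rw [← hij, mul_div_assoc, div_self hj', mul_one]
  rw [this, Pi.smul_apply, smul_eq_mul]
  ring

/-- The tangent space at `x` of a submanifold `M` of `ℙⁿ`. -/
def tangentAt (M : Set (ProjSpace 𝕜 n)) (x : ProjSpace 𝕜 n) : Set (MatSpace 𝕜 n) :=
  tangentVectors (projEmb '' M) (projEmb x)

/-! ### Stratifications of subsets of projective space -/

/-- `𝒮` is a stratification of the semialgebraic set `X ⊆ ℙⁿ`: a partition of `X` into
semialgebraic `C¹` submanifolds, locally finite in `ℙⁿ` (equivalently, as the image of
`projEmb` is compact, locally finite in the space of matrices). -/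
structure IsStratification (𝒮 : Set (Set (ProjSpace 𝕜 n))) (X : Set (ProjSpace 𝕜 n)) :
    Prop where
  semialgebraic : IsSemialgebraic (projEmb '' X)
  nonempty : ∀ S ∈ 𝒮, S.Nonempty
  disjoint : 𝒮.PairwiseDisjoint id
  sUnion_eq : ⋃₀ 𝒮 = X
  locallyFinite : LocallyFinite fun S : 𝒮 => projEmb '' (S : Set (ProjSpace 𝕜 n))
  stratum_semialgebraic : ∀ S ∈ 𝒮, IsSemialgebraic (projEmb '' S)
  stratum_submanifold : ∀ S ∈ 𝒮, IsC1Submanifold (projEmb '' S)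

/-- `(Y, 𝒯)` is a substratified object of `(X, 𝒮)`. -/
structure IsSubstratified (X : Set (ProjSpace 𝕜 n)) (𝒮 : Set (Set (ProjSpace 𝕜 n)))
    (Y : Set (ProjSpace 𝕜 n)) (𝒯 : Set (Set (ProjSpace 𝕜 n))) : Prop where
  subset : Y ⊆ X
  stratification : IsStratification 𝒯 Y
  exists_stratum : ∀ T ∈ 𝒯, ∃ S ∈ 𝒮, T ⊆ S

/-- The submanifolds `A`, `B` of `S` are transverse in `S`. -/
def TransverseIn (S A B : Set (ProjSpace 𝕜 n)) : Prop :=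
  ∀ x ∈ A ∩ B, {w | ∃ u ∈ tangentAt A x, ∃ v ∈ tangentAt B x, u + v = w} = tangentAt S x

/-- The substratified objects `(Z, 𝒜)` and `(W, ℬ)` of `(X, 𝒮)` are transverse in `(X, 𝒮)`. -/
structure StratifiedTransverse (X : Set (ProjSpace 𝕜 n)) (𝒮 : Set (Set (ProjSpace 𝕜 n)))
    (Z : Set (ProjSpace 𝕜 n)) (𝒜 : Set (Set (ProjSpace 𝕜 n)))
    (W : Set (ProjSpace 𝕜 n)) (ℬ : Set (Set (ProjSpace 𝕜 n))) : Prop where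
  left : IsSubstratified X 𝒮 Z 𝒜
  right : IsSubstratified X 𝒮 W ℬ
  transverse : ∀ S ∈ 𝒮, ∀ A ∈ 𝒜, ∀ B ∈ ℬ, A ⊆ S → B ⊆ S → TransverseIn S A B

/-! ### Stratified submersive families of diffeomorphisms -/

/-- `Ψ` restricts to a submersive family of diffeomorphisms `U × S → S`, where `U` is open in
`𝕜ᵐ` and `S` is a submanifold of `ℙⁿ`. (On a submanifold, `ContDiffOn ℝ 1` is the usual notion
of a `C¹` map.) -/
structure IsSubmersiveFamily {m : ℕ} (U : Set (Fin m → 𝕜)) (S : Set (ProjSpace 𝕜 n))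
    (Ψ : (Fin m → 𝕜) → ProjSpace 𝕜 n → ProjSpace 𝕜 n) : Prop where
  /-- `Ψ : U × S → S` is `C¹`. -/
  smooth : ∃ F : (Fin m → 𝕜) × MatSpace 𝕜 n → MatSpace 𝕜 n,
    ContDiffOn ℝ 1 F (U ×ˢ (projEmb '' S)) ∧
      ∀ t ∈ U, ∀ x ∈ S, F (t, projEmb x) = projEmb (Ψ t x)
  /-- Each `Ψ_t : S → S` is bijective, -/
  bijOn : ∀ t ∈ U, BijOn (Ψ t) S S
  /-- with `C¹` inverse. -/
  smooth_inv : ∀ t ∈ U, ∃ G : MatSpace 𝕜 n → MatSpace 𝕜 n,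
    ContDiffOn ℝ 1 G (projEmb '' S) ∧ ∀ x ∈ S, G (projEmb (Ψ t x)) = projEmb x
  /-- The differential of `Ψ^x : U → S` at each `t` is onto the tangent space of `S`. -/
  submersive : ∀ t ∈ U, ∀ x ∈ S,
    Set.range (fderiv ℝ (fun s => projEmb (Ψ s x)) t) = tangentAt S (Ψ t x)

/-- `Ψ` is a stratified submersive family of diffeomorphisms: it preserves each stratum of `𝒮` and
restricts on it to a submersive family of diffeomorphisms. -/
def IsStratifiedSubmersiveFamily {m : ℕ} (U : Set (Fin m → 𝕜))
    (𝒮 : Set (Set (ProjSpace 𝕜 n)))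
    (Ψ : (Fin m → 𝕜) → ProjSpace 𝕜 n → ProjSpace 𝕜 n) : Prop :=
  ∀ S ∈ 𝒮, IsSubmersiveFamily U S Ψ

/-- `Ψ : U × ℙⁿ → ℙⁿ` is semialgebraic: its graph is a semialgebraic set. -/
def IsSemialgebraicFamily {m : ℕ} (U : Set (Fin m → 𝕜))
    (Ψ : (Fin m → 𝕜) → ProjSpace 𝕜 n → ProjSpace 𝕜 n) : Prop :=
  IsSemialgebraic {q : (Fin m → 𝕜) × MatSpace 𝕜 n × MatSpace 𝕜 n |
    q.1 ∈ U ∧ ∃ x, q.2.1 = projEmb x ∧ q.2.2 = projEmb (Ψ q.1 x)}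

end Projective

end

/-! ### Sign-equivalence of families of real polynomials -/

section SignPosition

open Polynomial

/-! The argument is a parametric transversality theorem in which semialgebraic geometry replaces
Sard's theorem. Fix strata `A`, `B` inside one stratum `S`. Call `(t, x)` bad if `x` lies in `A` and
in `Ψ_t⁻¹(B)` and these two manifolds are not transverse in `S` at `x`. It suffices that the bad
parameters, the projection of the bad set to the parameter space, lie in the zero set of a nonzero
polynomial. Stratifications are finite by compactness of projective space, so multiplying these
polynomials over all triples `(S, A, B)` gives one polynomial whose nonvanishing defines the
required parameters.

The bad set is semialgebraic because tangent spaces of submanifolds are sets of limits of secants, a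
first-order condition (`tangentVectors_eq_secantLimits`), and its projection is semialgebraic by
Tarski–Seidenberg. A semialgebraic set minus its interior lies in a proper algebraic set, so only
emptiness of the interior is at stake.

If the interior were nonempty, some nonempty open set of parameters would carry a differentiable
choice `t ↦ σ(t)` of bad points (`exists_differentiable_section`). Let `w` be tangent to `S` at
`σ(t₀)`. By submersivity `∂ₓΨ·w = ∂ₜΨ·τ` for some `τ`. Put `u = dσ(τ)`, which is tangent to `A`.
Differentiating `Ψ(t, σ(t)) ∈ B` along `τ` shows that `∂ₜΨ·τ + ∂ₓΨ·u = ∂ₓΨ·(w + u)` is tangent to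
`B`. Hence `w + u` is tangent to `Ψ_{t₀}⁻¹(B)`, and `w = -u + (w + u)` shows transversality at a bad
point, a contradiction (`exists_add_eq_of_section`).

Tarski–Seidenberg is proved by the Cohen–Hörmander method. Signs of finitely many coefficients
determine the sign diagram of a finite family of real polynomials (`signDetermined_of_finite`),
where equality of diagrams is expressed by finite order isomorphisms between marked points.
Differentiable sections come from simple roots of derivatives of the defining polynomials, the
implicit function theorem and Baire's theorem. -/

/-- `x` and `y` have the same position with respect to the pairs in `T`. -/
def SamePos (T : Set (ℝ × ℝ)) (x y : ℝ) : Prop :=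
  ∀ p ∈ T, (p.1 < x ↔ p.2 < y) ∧ (x < p.1 ↔ y < p.2)

/-- `T` is a finite strictly increasing relation. -/
structure IsPartialIso (T : Set (ℝ × ℝ)) : Prop where
  finite : T.Finite
  samePos : ∀ p ∈ T, SamePos T p.1 p.2

variable {T T' : Set (ℝ × ℝ)} {x x' y y' z : ℝ}

theorem SamePos.mono (h : SamePos T x y) (hT : T' ⊆ T) : SamePos T' x y :=
  fun p hp => h p (hT hp)

theorem SamePos.swap (h : SamePos T x y) : SamePos (Prod.swap ⁻¹' T) y x :=
  fun _ hp => ⟨(h _ hp).1.symm, (h _ hp).2.symm⟩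

theorem SamePos.trans (h : SamePos T x y) (h' : SamePos T x' y) (h'' : SamePos T x y') :
    SamePos T x' y' := fun p hp => by
  have h1 := h p hp
  have h2 := h' p hp
  have h3 := h'' p hp
  exact ⟨h2.1.trans (h1.1.symm.trans h3.1), h2.2.trans (h1.2.symm.trans h3.2)⟩

theorem SamePos.between (h : SamePos T x y) (h' : SamePos T x' y) (h1 : x ≤ z) (h2 : z ≤ x') :
    SamePos T z y := fun p hp => by
  obtain ⟨a, b⟩ := h p hp
  obtain ⟨c, d⟩ := h' p hp
  exact ⟨⟨fun h => c.1 (h.trans_le h2), fun h => (a.2 h).trans_le h1⟩,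
    ⟨fun h => b.1 (h1.trans_lt h), fun h => h2.trans_lt (d.2 h)⟩⟩

theorem SamePos.between' (h : SamePos T x y) (h' : SamePos T x y') (h1 : y ≤ z) (h2 : z ≤ y') :
    SamePos T x z :=
  (h.swap.between h'.swap h1 h2).swap

theorem SamePos.eq_snd (h : SamePos T x y) {p : ℝ × ℝ} (hp : p ∈ T) (hx : p.1 = x) :
    p.2 = y := by
  obtain ⟨a, b⟩ := h p hp
  subst hx
  simp only [lt_irrefl, false_iff, not_lt] at a b
  exact le_antisymm b a

theorem SamePos.eq_fst (h : SamePos T x y) {p : ℝ × ℝ} (hp : p ∈ T) (hy : p.2 = y) :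
    p.1 = x :=
  h.swap.eq_snd (p := p.swap) hp hy

theorem IsPartialIso.swap (hT : IsPartialIso T) : IsPartialIso (Prod.swap ⁻¹' T) where
  finite := hT.finite.preimage Prod.swap_injective.injOn
  samePos p hp := (hT.samePos p.swap hp).swap

theorem IsPartialIso.subset (hT : IsPartialIso T) (h : T' ⊆ T) : IsPartialIso T' where
  finite := hT.finite.subset h
  samePos p hp := (hT.samePos p (h hp)).mono h

/-- The one-point extension step of Cantor's back-and-forth argument: cells cut out by the marked
points on the two sides correspond, and none is matched with an empty one. -/
theorem IsPartialIso.exists_samePos (hT : IsPartialIso T) (x : ℝ) : ∃ y, SamePos T x y := by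
  obtain ⟨y, hy⟩ := Order.PartialIso.exists_across (α := ℝ) (β := ℝ)
    ⟨hT.finite.toFinset, fun p hp q hq => by
      have h := hT.samePos q (by simpa using hq) p (by simpa using hp)
      rcases lt_trichotomy p.1 q.1 with h1 | h1 | h1
      · rw [cmp_eq_lt_iff _ _ |>.2 h1, cmp_eq_lt_iff _ _ |>.2 (h.1.1 h1)]
      · rw [cmp_eq_eq_iff _ _ |>.2 h1, eq_comm, cmp_eq_eq_iff]
        exact (hT.samePos q (by simpa using hq)).eq_snd (by simpa using hp) h1
      · rw [cmp_eq_gt_iff _ _ |>.2 h1, cmp_eq_gt_iff _ _ |>.2 (h.2.1 h1)]⟩ x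
  refine ⟨y, fun p hp => ?_⟩
  have h := hy p (by simpa using hp)
  exact ⟨lt_iff_lt_of_cmp_eq_cmp h, lt_iff_lt_of_cmp_eq_cmp (cmp_eq_cmp_symm.1 h)⟩

theorem IsPartialIso.exists_samePos' (hT : IsPartialIso T) (y : ℝ) : ∃ x, SamePos T x y := by
  obtain ⟨x, hx⟩ := hT.swap.exists_samePos y
  exact ⟨x, hx.swap⟩

/-- Since `f` increases on the cell of `x` and `f x ≤ 0`, it is negative at the left end of the
cell, which is a marked point or `-∞`. There `g` has the same sign, and by continuity `g` stays
negative just inside the corresponding cell. -/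
theorem exists_neg_of_samePos_of_incr (hT : IsPartialIso T) {f g : ℝ → ℝ}
    (hg : Continuous g) (hfg : ∀ p ∈ T, SignType.sign (f p.1) = SignType.sign (g p.2))
    {s : SignType} (hf : ∀ᶠ z in atBot, SignType.sign (f z) = s)
    (hgs : ∀ᶠ z in atBot, SignType.sign (g z) = s)
    (hxy : SamePos T x y) (hxT : ∀ p ∈ T, p.1 ≠ x) (hx : f x ≤ 0)
    (hmono : ∀ u < x, (∀ z ∈ Ioo u x, SamePos T z y) → f u < f x) :
    ∃ y', SamePos T x y' ∧ g y' < 0 := by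
  by_cases hL : ∃ p ∈ T, p.1 < x
  · obtain ⟨p, ⟨hpT, hpx⟩, hmax⟩ := Set.exists_max_image {p ∈ T | p.1 < x} Prod.fst
      (hT.finite.subset (sep_subset _ _)) hL
    have hfp : f p.1 < 0 := (hmono _ hpx fun z hz q hq => by
      obtain ⟨a, b⟩ := hxy q hq
      rcases lt_trichotomy q.1 x with h | h | h
      · have := hmax q ⟨hq, h⟩
        refine ⟨⟨fun _ => a.1 h, fun _ => this.trans_lt hz.1⟩,
          ⟨fun h' => ?_, fun h' => absurd (a.1 h) h'.not_gt⟩⟩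
        exact absurd (hz.1.trans h') this.not_gt
      · exact absurd h (hxT q hq)
      · exact ⟨⟨fun h' => absurd (h'.trans hz.2) h.not_gt, fun h' => absurd (b.1 h) h'.not_gt⟩,
          ⟨fun _ => b.1 h, fun _ => hz.2.trans h⟩⟩).trans_le hx
    have hgp : g p.2 < 0 := by
      rw [← sign_eq_neg_one_iff, ← hfg p hpT, sign_eq_neg_one_iff]; exact hfp
    have hpy : p.2 < y := (hxy p hpT).1.1 hpx
    have h1 : ∀ᶠ z in 𝓝[>] p.2, g z < 0 :=
      nhdsWithin_le_nhds (hg.continuousAt.eventually_lt continuousAt_const hgp)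
    obtain ⟨y', hy', hy'2⟩ := (h1.and (Ioo_mem_nhdsGT hpy)).exists
    refine ⟨y', fun q hq => ?_, hy'⟩
    obtain ⟨a, b⟩ := hxy q hq
    rcases lt_trichotomy q.1 x with h | h | h
    · have hqp : q.2 ≤ p.2 := by
        have h' := (hT.samePos p hpT q hq).2
        exact not_lt.1 fun hlt => (hmax q ⟨hq, h⟩).not_gt (h'.2 hlt)
      exact ⟨⟨fun _ => hqp.trans_lt hy'2.1, fun _ => h⟩,
        ⟨fun h' => absurd h h'.not_gt, fun h' => absurd (hqp.trans_lt hy'2.1) h'.not_gt⟩⟩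
    · exact absurd h (hxT q hq)
    · have := hy'2.2.trans (b.1 h)
      exact ⟨⟨fun h' => absurd h h'.not_gt, fun h' => absurd this h'.not_gt⟩,
        ⟨fun _ => this, fun _ => h⟩⟩
  · push Not at hL
    have hs : s = -1 := by
      obtain ⟨u, hu, hux⟩ := (hf.and (eventually_lt_atBot x)).exists
      rw [← hu, sign_eq_neg_one_iff]
      refine (hmono u hux fun z hz q hq => ?_).trans_le hx
      have h := (hL q hq).lt_of_ne (hxT q hq).symm
      have h2 := (hxy q hq).2.1 h
      exact ⟨⟨fun h' => absurd (h'.trans hz.2) h.not_gt, fun h' => absurd h2 h'.not_gt⟩,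
          ⟨fun _ => h2, fun _ => hz.2.trans h⟩⟩
    obtain ⟨y', hy', hy'y⟩ := (hgs.and (eventually_lt_atBot y)).exists
    refine ⟨y', fun q hq => ?_, by rwa [hs, sign_eq_neg_one_iff] at hy'⟩
    have h := (hL q hq).lt_of_ne (hxT q hq).symm
    have h2 := hy'y.trans ((hxy q hq).2.1 h)
    exact ⟨⟨fun h' => absurd h' h.not_gt, fun h' => absurd h2 h'.not_gt⟩,
          ⟨fun _ => h2, fun _ => h⟩⟩

theorem SamePos.neg (h : SamePos T x y) : SamePos (Neg.neg ⁻¹' T) (-x) (-y) := fun p hp => by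
  obtain ⟨a, b⟩ := h _ hp
  simp only [Prod.fst_neg, Prod.snd_neg] at a b
  exact ⟨by rw [lt_neg, b, lt_neg], by rw [neg_lt, a, neg_lt]⟩

theorem IsPartialIso.neg (hT : IsPartialIso T) : IsPartialIso (Neg.neg ⁻¹' T) where
  finite := hT.finite.preimage neg_injective.injOn
  samePos p hp := by simpa using (hT.samePos _ hp).neg

/-- The increasing case reflected by `x ↦ -x`. -/
theorem exists_neg_of_samePos_of_decr (hT : IsPartialIso T) {f g : ℝ → ℝ}
    (hg : Continuous g) (hfg : ∀ p ∈ T, SignType.sign (f p.1) = SignType.sign (g p.2))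
    {s : SignType} (hf : ∀ᶠ z in atTop, SignType.sign (f z) = s)
    (hgs : ∀ᶠ z in atTop, SignType.sign (g z) = s)
    (hxy : SamePos T x y) (hxT : ∀ p ∈ T, p.1 ≠ x) (hx : f x ≤ 0)
    (hmono : ∀ u, x < u → (∀ z ∈ Ioo x u, SamePos T z y) → f u < f x) :
    ∃ y', SamePos T x y' ∧ g y' < 0 := by
  obtain ⟨y', h1, h2⟩ := exists_neg_of_samePos_of_incr (f := fun z => f (-z))
    (g := fun z => g (-z)) hT.neg (hg.comp continuous_neg) (fun p hp => hfg _ hp)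
    (tendsto_neg_atBot_atTop.eventually hf) (tendsto_neg_atBot_atTop.eventually hgs) hxy.neg
    (fun p hp h => hxT _ hp (by simp [h])) (by simpa using hx) (fun u hu h => by
      rw [neg_neg]
      refine hmono _ (lt_neg.1 hu) fun z hz => ?_
      have := (h (-z) ⟨lt_neg.1 hz.2, neg_lt_neg hz.1⟩).neg
      simpa [Set.preimage_preimage] using this)
  exact ⟨-y', by simpa [Set.preimage_preimage] using h1.neg, h2⟩

theorem strictMono_of_derivative_pos {p : ℝ[X]} (h : ∀ z ∈ Ioo x y, 0 < p.derivative.eval z)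
    (hxy : x < y) : p.eval x < p.eval y :=
  strictMonoOn_of_deriv_pos (convex_Icc x y) p.continuous.continuousOn
    (fun z hz => by rw [Polynomial.deriv]; rw [interior_Icc] at hz; exact h z hz)
    (left_mem_Icc.2 hxy.le) (right_mem_Icc.2 hxy.le) hxy

theorem strictAnti_of_derivative_neg {p : ℝ[X]} (h : ∀ z ∈ Ioo x y, p.derivative.eval z < 0)
    (hxy : x < y) : p.eval y < p.eval x := by
  have := strictMono_of_derivative_pos (p := -p) (x := x) (y := y)
    (fun z hz => by simpa using h z hz) hxy
  simpa using this

/-- The hypotheses under which a pair of polynomials can be added to a sign-equivalence. -/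
structure SignExtendable (T : Set (ℝ × ℝ)) (p q : ℝ[X]) : Prop where
  iso : IsPartialIso T
  derivative_ne_zero : p.derivative ≠ 0
  derivative_ne_zero' : q.derivative ≠ 0
  derivative : ∀ x y, SamePos T x y →
    SignType.sign (p.derivative.eval x) = SignType.sign (q.derivative.eval y)
  critical : ∀ x y, SamePos T x y → p.derivative.eval x = 0 →
    SignType.sign (p.eval x) = SignType.sign (q.eval y)
  marked : ∀ r ∈ T, SignType.sign (p.eval r.1) = SignType.sign (q.eval r.2)
  atBot : ∃ s, (∀ᶠ z in atBot, SignType.sign (p.eval z) = s) ∧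
    ∀ᶠ z in atBot, SignType.sign (q.eval z) = s
  atTop : ∃ s, (∀ᶠ z in atTop, SignType.sign (p.eval z) = s) ∧
    ∀ᶠ z in atTop, SignType.sign (q.eval z) = s

namespace SignExtendable

variable {p q : ℝ[X]}

theorem swap (h : SignExtendable T p q) : SignExtendable (Prod.swap ⁻¹' T) q p where
  iso := h.iso.swap
  derivative_ne_zero := h.derivative_ne_zero'
  derivative_ne_zero' := h.derivative_ne_zero
  derivative x y hxy := (h.derivative y x hxy.swap).symm
  critical x y hxy h0 := (h.critical y x hxy.swap (by
    have := h.derivative y x hxy.swap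
    rwa [h0, sign_zero, sign_eq_zero_iff] at this)).symm
  marked r hr := (h.marked _ hr).symm
  atBot := let ⟨s, h1, h2⟩ := h.atBot; ⟨s, h2, h1⟩
  atTop := let ⟨s, h1, h2⟩ := h.atTop; ⟨s, h2, h1⟩

theorem neg (h : SignExtendable T p q) : SignExtendable T (-p) (-q) where
  iso := h.iso
  derivative_ne_zero := by simpa using h.derivative_ne_zero
  derivative_ne_zero' := by simpa using h.derivative_ne_zero'
  derivative x y hxy := by simpa [Left.sign_neg] using h.derivative x y hxy
  critical x y hxy h0 := by
    simpa [Left.sign_neg] using h.critical x y hxy (by simpa using h0)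
  marked r hr := by simpa [Left.sign_neg] using h.marked r hr
  atBot := let ⟨s, h1, h2⟩ := h.atBot; ⟨-s, by simpa [Left.sign_neg] using h1,
    by simpa [Left.sign_neg] using h2⟩
  atTop := let ⟨s, h1, h2⟩ := h.atTop; ⟨-s, by simpa [Left.sign_neg] using h1,
    by simpa [Left.sign_neg] using h2⟩

theorem derivative_sign_eq (h : SignExtendable T p q) (hxy : SamePos T x y)
    (hx'y : SamePos T x' y) :
    SignType.sign (p.derivative.eval x) = SignType.sign (p.derivative.eval x') :=
  (h.derivative x y hxy).trans (h.derivative x' y hx'y).symm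

theorem exists_neg (h : SignExtendable T p q) (hxy : SamePos T x y) (hxT : ∀ r ∈ T, r.1 ≠ x)
    (hd : p.derivative.eval x ≠ 0) (hx : p.eval x ≤ 0) :
    ∃ y', SamePos T x y' ∧ q.eval y' < 0 := by
  rcases hd.lt_or_gt with hd | hd
  · obtain ⟨s, h1, h2⟩ := h.atTop
    refine exists_neg_of_samePos_of_decr h.iso q.continuous h.marked h1 h2 hxy hxT hx
      fun u hu hz => strictAnti_of_derivative_neg (fun z hzu => ?_) hu
    rw [← sign_eq_neg_one_iff, ← h.derivative_sign_eq hxy (hz z hzu), sign_eq_neg_one_iff]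
    exact hd
  · obtain ⟨s, h1, h2⟩ := h.atBot
    refine exists_neg_of_samePos_of_incr h.iso q.continuous h.marked h1 h2 hxy hxT hx
      fun u hu hz => strictMono_of_derivative_pos (fun z hzu => ?_) hu
    rw [← sign_eq_one_iff, ← h.derivative_sign_eq hxy (hz z hzu), sign_eq_one_iff]
    exact hd

theorem exists_pos (h : SignExtendable T p q) (hxy : SamePos T x y) (hxT : ∀ r ∈ T, r.1 ≠ x)
    (hd : p.derivative.eval x ≠ 0) (hx : 0 ≤ p.eval x) :
    ∃ y', SamePos T x y' ∧ 0 < q.eval y' := by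
  simpa using h.neg.exists_neg hxy hxT (by simpa using hd) (by simpa using hx)

/-- The pairs of roots of `p` and `q` in corresponding cells. -/
def rootPairs (T : Set (ℝ × ℝ)) (p q : ℝ[X]) : Set (ℝ × ℝ) :=
  {r | p.eval r.1 = 0 ∧ q.eval r.2 = 0 ∧ SamePos T r.1 r.2}

theorem rootPairs_swap (T : Set (ℝ × ℝ)) (p q : ℝ[X]) :
    Prod.swap ⁻¹' rootPairs T p q = rootPairs (Prod.swap ⁻¹' T) q p := by
  ext r
  constructor
  · rintro ⟨h1, h2, h3⟩
    exact ⟨h2, h1, h3.swap⟩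
  · rintro ⟨h1, h2, h3⟩
    exact ⟨h2, h1, h3.swap⟩

theorem exists_root_between {p : ℝ[X]} (hx : p.eval x ≤ 0) (hy : 0 ≤ p.eval y) :
    ∃ z ∈ uIcc x y, p.eval z = 0 := by
  have := intermediate_value_uIcc (f := fun z => p.eval z) (a := x) (b := y)
    p.continuous.continuousOn
  obtain ⟨z, hz, hz0⟩ := this (mem_uIcc_of_le hx hy)
  exact ⟨z, hz, hz0⟩

theorem samePos_uIcc (hxy : SamePos T x y) (hx'y : SamePos T x' y) (hz : z ∈ uIcc x x') :
    SamePos T z y := by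
  rcases mem_uIcc.1 hz with ⟨a, b⟩ | ⟨a, b⟩
  · exact hxy.between hx'y a b
  · exact hx'y.between hxy a b

/-- Away from marked and critical points, `p` and `q` are strictly monotone in the same direction on
corresponding cells. If the signs disagreed, both would change sign in their cells and have roots
`c` and `d` there. The pair `(c, d)` is marked, so `x` and `y` lie on the same side of it, and
monotonicity then makes the signs agree. -/
theorem neg_of_neg (h : SignExtendable T p q) (hxy : SamePos (T ∪ rootPairs T p q) x y)
    (hx : p.eval x < 0) : q.eval y < 0 := by
  have hxyT : SamePos T x y := hxy.mono subset_union_left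
  by_cases hxT : ∃ r ∈ T, r.1 = x
  · obtain ⟨r, hr, rfl⟩ := hxT
    obtain rfl := hxyT.eq_snd hr rfl
    rwa [← sign_eq_neg_one_iff, ← h.marked r hr, sign_eq_neg_one_iff]
  push Not at hxT
  by_cases hd : p.derivative.eval x = 0
  · rwa [← sign_eq_neg_one_iff, ← h.critical x y hxyT hd, sign_eq_neg_one_iff]
  by_contra! hy
  have hd' : q.derivative.eval y ≠ 0 := fun h0 => hd (by
    have := h.derivative x y hxyT
    rwa [h0, sign_zero, sign_eq_zero_iff] at this)
  obtain ⟨x', hx', hpx'⟩ := h.swap.exists_pos hxyT.swap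
    (fun r hr he => hxT _ hr (hxyT.eq_fst hr he)) hd' hy
  obtain ⟨y', hy', hqy'⟩ := h.exists_neg hxyT hxT hd hx.le
  obtain ⟨c, hc, hpc⟩ := exists_root_between hx.le hpx'.le
  obtain ⟨d, hd2, hqd⟩ := exists_root_between hqy'.le hy
  have hcy : SamePos T c y := samePos_uIcc hxyT hx'.swap hc
  have hxd : SamePos T x d := (samePos_uIcc hy'.swap hxyT.swap hd2).swap
  have hcd : SamePos T c d := hxyT.trans hcy hxd
  obtain ⟨h1, h2⟩ := hxy (c, d) (Or.inr ⟨hpc, hqd, hcd⟩)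
  simp only at h1 h2
  rcases lt_trichotomy c x with hlt | rfl | hlt
  · have hyd := h1.1 hlt
    rcases lt_or_gt_of_ne hd with hneg | hpos
    · have := strictAnti_of_derivative_neg (p := q) (fun z hz => by
        rw [← sign_eq_neg_one_iff, ← h.derivative x z (hxd.between' hxyT hz.1.le hz.2.le),
          sign_eq_neg_one_iff]; exact hneg) hyd
      linarith
    · have := strictMono_of_derivative_pos (p := p) (fun z hz => by
        rw [← sign_eq_one_iff, ← h.derivative_sign_eq hxyT (hcy.between hxyT hz.1.le hz.2.le),
          sign_eq_one_iff]; exact hpos) hlt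
      linarith
  · linarith
  · have hyd := h2.1 hlt
    rcases lt_or_gt_of_ne hd with hneg | hpos
    · have := strictAnti_of_derivative_neg (p := p) (fun z hz => by
        rw [← sign_eq_neg_one_iff,
          ← h.derivative_sign_eq hxyT (hxyT.between hcy hz.1.le hz.2.le),
          sign_eq_neg_one_iff]; exact hneg) hlt
      linarith
    · have := strictMono_of_derivative_pos (p := q) (fun z hz => by
        rw [← sign_eq_one_iff, ← h.derivative x z (hxyT.between' hxd hz.1.le hz.2.le),
          sign_eq_one_iff]; exact hpos) hyd
      linarith

theorem pos_of_pos (h : SignExtendable T p q) (hxy : SamePos (T ∪ rootPairs T p q) x y)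
    (hx : 0 < p.eval x) : 0 < q.eval y := by
  have : rootPairs T (-p) (-q) = rootPairs T p q := by ext r; simp [rootPairs]
  simpa using h.neg.neg_of_neg (x := x) (y := y) (by rwa [this]) (by simpa using hx)

theorem sign_eq (h : SignExtendable T p q) (hxy : SamePos (T ∪ rootPairs T p q) x y) :
    SignType.sign (p.eval x) = SignType.sign (q.eval y) := by
  have hyx : SamePos (Prod.swap ⁻¹' T ∪ rootPairs (Prod.swap ⁻¹' T) q p) y x := by
    rw [← rootPairs_swap]; exact hxy.swap
  rcases lt_trichotomy (p.eval x) 0 with h1 | h1 | h1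
  · rw [sign_neg h1, sign_neg (h.neg_of_neg hxy h1)]
  · rcases lt_trichotomy (q.eval y) 0 with h2 | h2 | h2
    · have := h.swap.neg_of_neg hyx h2
      linarith
    · rw [h1, h2]
    · have := h.swap.pos_of_pos hyx h2
      linarith
  · rw [sign_pos h1, sign_pos (h.pos_of_pos hxy h1)]

/-- A marked pair between the two roots transfers the order. Otherwise the interval between the
roots lies in one cell. Rolle's theorem gives a zero of the derivative there, and constancy of its
sign on the cell makes it vanish identically. -/
theorem rootPairs_lt (h : SignExtendable T p q) {r r' : ℝ × ℝ} (hr : r ∈ rootPairs T p q)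
    (hr' : r' ∈ rootPairs T p q) (hlt : r.1 < r'.1) : r.2 < r'.2 := by
  obtain ⟨hc, hd, hcd⟩ := hr
  obtain ⟨hc', hd', hcd'⟩ := hr'
  by_cases hex : ∃ s ∈ T, r.1 ≤ s.1 ∧ s.1 ≤ r'.1
  · obtain ⟨s, hs, h1, h2⟩ := hex
    have h3 : r.2 ≤ s.2 := not_lt.1 fun h => h1.not_gt ((hcd s hs).1.2 h)
    have h4 : s.2 ≤ r'.2 := not_lt.1 fun h => h2.not_gt ((hcd' s hs).2.2 h)
    refine (h3.trans h4).lt_of_ne fun he => hlt.ne ?_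
    rw [← hcd.eq_fst hs (le_antisymm (h4.trans he.ge) h3),
      ← hcd'.eq_fst hs (le_antisymm h4 (he.ge.trans h3))]
  · exfalso
    push Not at hex
    have hcell : ∀ z ∈ Ioo r.1 r'.1, SamePos T z r.2 := fun z hz s hs => by
      obtain ⟨a, b⟩ := hcd s hs
      rw [← a, ← b]
      refine ⟨⟨fun hsz => ?_, fun hsr => hsr.trans hz.1⟩,
        ⟨fun hzs => hz.1.trans hzs, fun hrs => (hz.2.trans (hex s hs hrs.le))⟩⟩
      by_contra! hn
      exact (hsz.trans hz.2).not_gt (hex s hs hn)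
    obtain ⟨e, he, he0⟩ := exists_deriv_eq_zero hlt p.continuous.continuousOn
      (by rw [hc, hc'])
    rw [Polynomial.deriv] at he0
    refine h.derivative_ne_zero (p.derivative.eq_zero_of_infinite_isRoot
      ((Ioo_infinite hlt).mono fun z hz => ?_))
    have := h.derivative_sign_eq (hcell e he) (hcell z hz)
    rw [he0, sign_zero, eq_comm, sign_eq_zero_iff] at this
    exact this

theorem isPartialIso (h : SignExtendable T p q) : IsPartialIso (T ∪ rootPairs T p q) where
  finite := by
    refine h.iso.finite.union (((p.roots.toFinset.finite_toSet).prod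
      (q.roots.toFinset.finite_toSet)).subset fun r hr => ?_)
    have hp : p ≠ 0 := fun h0 => h.derivative_ne_zero (by simp [h0])
    have hq : q ≠ 0 := fun h0 => h.derivative_ne_zero' (by simp [h0])
    simpa [hp, hq] using ⟨hr.1, hr.2.1⟩
  samePos := by
    rintro r (hr | hr) s (hs | hs)
    · exact h.iso.samePos r hr s hs
    · obtain ⟨a, b⟩ := hs.2.2 r hr
      exact ⟨b, a⟩
    · exact hr.2.2 s hs
    · have key : ∀ {a b : ℝ × ℝ}, a ∈ rootPairs T p q → b ∈ rootPairs T p q →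
          (a.1 < b.1 ↔ a.2 < b.2) := fun {a b} ha hb =>
        ⟨h.rootPairs_lt ha hb, fun hlt => h.swap.rootPairs_lt (r := a.swap) (r' := b.swap)
          ⟨ha.2.1, ha.1, ha.2.2.swap⟩ ⟨hb.2.1, hb.1, hb.2.2.swap⟩ hlt⟩
      exact ⟨key hs hr, key hr hs⟩

end SignExtendable

end SignPosition

/-! ### Elimination: coefficient signs determine sign diagrams. -/

section SignDetermined

open Polynomial

section Univariate

variable {ι : Type*} {T : Set (ℝ × ℝ)} {s : Set ι} {p q : ι → ℝ[X]} {x y : ℝ}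

/-- An unmarked point has a neighbourhood inside its cell. Signs are constant on cells, so a root
there would give infinitely many roots. -/
theorem mem_of_samePos_of_root (hT : T.Finite)
    (hs : ∀ x y, SamePos T x y → ∀ i ∈ s,
      SignType.sign ((p i).eval x) = SignType.sign ((q i).eval y))
    {i : ι} (hi : i ∈ s) (hp : p i ≠ 0) (hx : (p i).eval x = 0) (hxy : SamePos T x y) :
    (x, y) ∈ T := by
  by_contra hn
  have hne : ∀ r ∈ T, r.1 ≠ x := fun r hr he => hn (by
    have := hxy.eq_snd hr he
    rwa [← he, ← this])
  have h1 : ∀ᶠ z in 𝓝 x, SamePos T z y := by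
    refine (eventually_all_finite hT).2 fun r hr => ?_
    rcases (hne r hr).lt_or_gt with h | h
    · filter_upwards [lt_mem_nhds h] with z hz
      rw [← (hxy r hr).1, ← (hxy r hr).2]
      exact ⟨iff_of_true hz h, iff_of_false hz.not_gt h.not_gt⟩
    · filter_upwards [gt_mem_nhds h] with z hz
      rw [← (hxy r hr).1, ← (hxy r hr).2]
      exact ⟨iff_of_false hz.not_gt h.not_gt, iff_of_true hz h⟩
  refine hp ((p i).eq_zero_of_infinite_isRoot ((infinite_of_mem_nhds x h1).mono fun z hz => ?_))
  have h2 := (hs z y hz i hi).trans (hs x y hxy i hi).symm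
  rw [hx, sign_zero, sign_eq_zero_iff] at h2
  exact h2

theorem sign_eq_of_no_root {p : ℝ[X]} (h : ∀ z ∈ uIcc x y, p.eval z ≠ 0) :
    SignType.sign (p.eval x) = SignType.sign (p.eval y) := by
  have hx := h x left_mem_uIcc
  have hy := h y right_mem_uIcc
  rcases hx.lt_or_gt with h1 | h1 <;> rcases hy.lt_or_gt with h2 | h2
  · rw [sign_neg h1, sign_neg h2]
  · obtain ⟨z, hz, h0⟩ := SignExtendable.exists_root_between h1.le h2.le
    exact absurd h0 (h z hz)
  · obtain ⟨z, hz, h0⟩ := SignExtendable.exists_root_between h2.le h1.le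
    exact absurd h0 (h z (by rwa [uIcc_comm]))
  · rw [sign_pos h1, sign_pos h2]

/-- A sign-equivalence of families still is one after all pairs are dropped that do not consist
of roots of members of the families. -/
theorem sign_eq_of_samePos_roots (hT : IsPartialIso T)
    (hs : ∀ x y, SamePos T x y → ∀ i ∈ s,
      SignType.sign ((p i).eval x) = SignType.sign ((q i).eval y))
    (h0 : ∀ i ∈ s, p i = 0 ↔ q i = 0)
    (hxy : SamePos {r ∈ T | ∃ i ∈ s, p i ≠ 0 ∧ (p i).eval r.1 = 0} x y) {i : ι} (hi : i ∈ s) :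
    SignType.sign ((p i).eval x) = SignType.sign ((q i).eval y) := by
  -- The point `y'` matches `x` for all of `T`, while `y` matches it only for the retained pairs. A
  -- root of `q i` between `y` and `y'` belongs to a retained pair, and that pair would separate
  -- them.
  obtain ⟨y', hy'⟩ := hT.exists_samePos x
  rw [hs x y' hy' i hi]
  by_cases hp : p i = 0
  · rw [(h0 i hi).1 hp]; simp
  by_cases hyy : y' = y
  · rw [hyy]
  refine sign_eq_of_no_root fun z hz hz0 => ?_
  obtain ⟨w, hw⟩ := hT.exists_samePos' z
  have hw0 : (p i).eval w = 0 := by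
    have := hs w z hw i hi
    rwa [hz0, sign_zero, sign_eq_zero_iff] at this
  have hwz := mem_of_samePos_of_root hT.finite hs hi hp hw0 hw
  obtain ⟨a, b⟩ := hxy (w, z) ⟨hwz, i, hi, hp, hw0⟩
  obtain ⟨c, d⟩ := hy' (w, z) hwz
  simp only at a b c d
  rw [a] at c
  rw [b] at d
  rcases mem_uIcc.1 hz with ⟨h1, h2⟩ | ⟨h1, h2⟩
  · rcases h2.lt_or_eq with h3 | rfl
    · exact h1.not_gt (c.1 h3)
    · exact (lt_irrefl _ (d.2 (h1.lt_of_ne hyy)))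
  · rcases h1.lt_or_eq with h3 | rfl
    · exact h2.not_gt (d.1 h3)
    · exact (lt_irrefl _ (c.2 (h2.lt_of_ne (Ne.symm hyy))))

theorem eventually_sign_eval_atTop (p : ℝ[X]) :
    ∀ᶠ z in atTop, SignType.sign (p.eval z) = SignType.sign p.leadingCoeff := by
  rcases Nat.eq_zero_or_pos p.natDegree with h | h
  · rw [natDegree_eq_zero] at h
    obtain ⟨c, rfl⟩ := h
    simp
  have hd : 0 < p.degree := natDegree_pos_iff_degree_pos.1 h
  rcases lt_trichotomy p.leadingCoeff 0 with h1 | h1 | h1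
  · filter_upwards [(p.tendsto_atBot_of_leadingCoeff_nonpos hd h1.le).eventually_lt_atBot 0]
      with z hz
    rw [sign_neg h1, sign_neg hz]
  · rw [leadingCoeff_eq_zero] at h1
    simp [h1] at h
  · filter_upwards [(p.tendsto_atTop_of_leadingCoeff_nonneg hd h1.le).eventually_gt_atTop 0]
      with z hz
    rw [sign_pos h1, sign_pos hz]

theorem eventually_sign_eval_atBot (p : ℝ[X]) :
    ∀ᶠ z in atBot, SignType.sign (p.eval z) =
      SignType.sign p.leadingCoeff * (-1) ^ p.natDegree := by
  have := tendsto_neg_atBot_atTop.eventually (eventually_sign_eval_atTop (p.comp (-X)))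
  filter_upwards [this] with z hz
  have h1 : (p.comp (-X : ℝ[X])).leadingCoeff = p.leadingCoeff * (-1) ^ p.natDegree := by
    rw [leadingCoeff_comp (by simp)]; simp
  rw [h1, sign_mul, sign_pow] at hz
  simpa using hz

end Univariate

/-! ### Pseudo-division and the induction on degrees. -/

variable {R : Type*} [CommRing R]

/-- The truncation of a polynomial to degree at most `k`. -/
noncomputable def truncDegree (k : ℕ) (Q : R[X]) : R[X] :=
  ∑ i ∈ Finset.range (k + 1), monomial i (Q.coeff i)

theorem coeff_truncDegree (k : ℕ) (Q : R[X]) (j : ℕ) :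
    (truncDegree k Q).coeff j = if j ≤ k then Q.coeff j else 0 := by
  simp [truncDegree, coeff_monomial]

theorem natDegree_truncDegree_le (k : ℕ) (Q : R[X]) : (truncDegree k Q).natDegree ≤ k :=
  natDegree_le_iff_coeff_eq_zero.2 fun j hj => by
    rw [coeff_truncDegree, if_neg (by lia)]

/-- The exponent is even so that the factor multiplying `P` is positive wherever the leading
coefficient of `Q` specializes to a nonzero number. At roots of `Q` the remainder then has the sign
of `P`. -/
theorem exists_pseudoRem (P Q : R[X]) (hQ : 0 < Q.natDegree) :
    ∃ (g A : R[X]) (k : ℕ), g.natDegree < Q.natDegree ∧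
      C (Q.leadingCoeff ^ (2 * k)) * P = Q * A + g := by
  suffices h : ∀ (n : ℕ) (P : R[X]), P.natDegree < n → ∃ (g A : R[X]) (k : ℕ),
      g.natDegree < Q.natDegree ∧ C (Q.leadingCoeff ^ k) * P = Q * A + g by
    obtain ⟨g, A, k, hg, h⟩ := h _ P (Nat.lt_succ_self _)
    refine ⟨C (Q.leadingCoeff ^ k) * g, C (Q.leadingCoeff ^ k) * A, k,
      (natDegree_C_mul_le _ _).trans_lt hg, ?_⟩
    rw [two_mul, pow_add, C_mul, mul_assoc, h]
    ring
  intro n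
  induction n with
  | zero => intro P hP; exact absurd hP (Nat.not_lt_zero _)
  | succ n ih =>
    intro P hP
    by_cases hPQ : P.natDegree < Q.natDegree
    · exact ⟨P, 0, 0, hPQ, by simp⟩
    push Not at hPQ
    set P₁ := C Q.leadingCoeff * P - C P.leadingCoeff * X ^ (P.natDegree - Q.natDegree) * Q
      with hP₁
    have hdeg : P₁.natDegree < P.natDegree := by
      have hle : P₁.natDegree ≤ P.natDegree - 1 := by
        rw [natDegree_le_iff_coeff_eq_zero]
        intro j hj
        have e : C P.leadingCoeff * X ^ (P.natDegree - Q.natDegree) * Q =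
          X ^ (P.natDegree - Q.natDegree) * (C P.leadingCoeff * Q) := by ring
        rw [hP₁, e, coeff_sub, coeff_C_mul, coeff_X_pow_mul', if_pos (by lia), coeff_C_mul]
        rcases (show P.natDegree ≤ j by lia).eq_or_lt with rfl | hlt
        · rw [Nat.sub_sub_self hPQ]
          simp only [coeff_natDegree]; ring
        · rw [coeff_eq_zero_of_natDegree_lt hlt, coeff_eq_zero_of_natDegree_lt (by lia)]
          simp
      lia
    obtain ⟨g, A, k, hg, h⟩ := ih P₁ (by lia)
    refine ⟨g, A + C (Q.leadingCoeff ^ k) * (C P.leadingCoeff *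
      X ^ (P.natDegree - Q.natDegree)), k + 1, hg, ?_⟩
    have e : C Q.leadingCoeff * P =
      P₁ + C P.leadingCoeff * X ^ (P.natDegree - Q.natDegree) * Q := by rw [hP₁]; ring
    rw [pow_succ, C_mul, mul_assoc, e, mul_add, h]
    ring

open Classical in
/-- A pseudo-remainder of `P` modulo `Q`. -/
noncomputable def pseudoRem (P Q : R[X]) : R[X] :=
  if h : 0 < Q.natDegree then (exists_pseudoRem P Q h).choose else 0

theorem natDegree_pseudoRem_le (P Q : R[X]) :
    (pseudoRem P Q).natDegree ≤ Q.natDegree - 1 := by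
  unfold pseudoRem
  split_ifs with h
  · have := (exists_pseudoRem P Q h).choose_spec.choose_spec.choose_spec.1
    lia
  · simp

theorem sign_eval_pseudoRem (P Q : R[X]) (h : 0 < Q.natDegree) (t : R →+* ℝ)
    (hl : t Q.leadingCoeff ≠ 0) {x : ℝ} (hx : (Q.map t).eval x = 0) :
    SignType.sign (((pseudoRem P Q).map t).eval x) = SignType.sign ((P.map t).eval x) := by
  obtain ⟨A, k, -, hs⟩ := (exists_pseudoRem P Q h).choose_spec
  rw [show (exists_pseudoRem P Q h).choose = pseudoRem P Q by
    unfold pseudoRem; rw [dif_pos h]] at hs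
  have h2 := congrArg (fun f => (f.map t).eval x) hs
  simp only [Polynomial.map_mul, Polynomial.map_add, eval_mul, eval_add, hx, zero_mul, zero_add,
    map_C, eval_C] at h2
  rw [← h2, sign_mul, map_pow, pow_mul, sign_pos (pow_pos (sq_pos_of_ne_zero hl) _), one_mul]

/-- The sign behaviour of the specializations of the polynomials in `F` is determined by the
signs of finitely many coefficients. -/
def SignDetermined (F : Set R[X]) : Prop :=
  ∃ C : Set R, C.Finite ∧ ∀ t t' : R →+* ℝ,
    (∀ c ∈ C, SignType.sign (t c) = SignType.sign (t' c)) →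
    ∃ T : Set (ℝ × ℝ), IsPartialIso T ∧ ∀ x y, SamePos T x y → ∀ P ∈ F,
      SignType.sign ((P.map t).eval x) = SignType.sign ((P.map t').eval y)

theorem signDetermined_empty : SignDetermined (∅ : Set R[X]) :=
  ⟨∅, finite_empty, fun _ _ _ => ⟨∅, ⟨finite_empty, by simp⟩, by simp⟩⟩

theorem SignDetermined.insert_const {F : Set R[X]} (hF : SignDetermined F) {P : R[X]}
    (hP : P.natDegree = 0) : SignDetermined (insert P F) := by
  obtain ⟨C, hC, h⟩ := hF
  obtain ⟨c, rfl⟩ := natDegree_eq_zero.1 hP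
  refine ⟨insert c C, hC.insert c, fun t t' ht => ?_⟩
  obtain ⟨T, hT, hs⟩ := h t t' fun c hc => ht c (mem_insert_of_mem _ hc)
  refine ⟨T, hT, fun x y hxy P hP => ?_⟩
  rcases hP with rfl | hP
  · simpa using ht c (mem_insert _ _)
  · exact hs x y hxy P hP

theorem map_truncDegree {Q : R[X]} {t : R →+* ℝ} {k : ℕ} (hk : (Q.map t).natDegree ≤ k) :
    (truncDegree k Q).map t = Q.map t := by
  ext j
  rw [coeff_map, coeff_map, coeff_truncDegree]
  split_ifs with h
  · rfl
  · rw [map_zero, ← coeff_map, coeff_eq_zero_of_natDegree_lt (by lia)]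

theorem sign_eval_pseudoRem_truncDegree (P Q : R[X]) (t : R →+* ℝ) {x : ℝ} {k : ℕ}
    (hk : (Q.map t).natDegree = k) (hk0 : 0 < k) (hx : (Q.map t).eval x = 0) :
    SignType.sign (((pseudoRem P (truncDegree k Q)).map t).eval x) =
      SignType.sign ((P.map t).eval x) := by
  have hc : t (Q.coeff k) ≠ 0 := by
    rw [← coeff_map, ← hk, coeff_natDegree, Ne, leadingCoeff_eq_zero]
    rintro h0
    simp [h0] at hk
    lia
  have hd : (truncDegree k Q).natDegree = k := by
    refine le_antisymm (natDegree_truncDegree_le _ _) (le_natDegree_of_ne_zero ?_)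
    rw [coeff_truncDegree, if_pos le_rfl]
    exact fun h => hc (by rw [h, map_zero])
  refine sign_eval_pseudoRem _ _ (by rwa [hd]) t ?_ (by rwa [map_truncDegree hk.le])
  rwa [leadingCoeff, hd, coeff_truncDegree, if_pos le_rfl]

/-- The family on which the sign behaviour of `insert P G` depends if the leading coefficient of
`P` does not vanish. -/
def pseudoRemFamily (P : R[X]) (G : Set R[X]) : Set R[X] :=
  G ∪ ⋃ Q ∈ G, (fun k => pseudoRem P (truncDegree k Q)) '' Icc 1 Q.natDegree

theorem natDegree_map_eq {Q : R[X]} {t t' : R →+* ℝ}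
    (h : ∀ i, SignType.sign (t (Q.coeff i)) = SignType.sign (t' (Q.coeff i))) :
    (Q.map t).natDegree = (Q.map t').natDegree := by
  have key : ∀ i, (Q.map t).coeff i = 0 ↔ (Q.map t').coeff i = 0 := fun i => by
    rw [coeff_map, coeff_map, ← sign_eq_zero_iff, h i, sign_eq_zero_iff]
  refine le_antisymm ?_ ?_ <;> rw [natDegree_le_iff_coeff_eq_zero] <;> intro j hj
  · exact (key j).2 (coeff_eq_zero_of_natDegree_lt hj)
  · exact (key j).1 (coeff_eq_zero_of_natDegree_lt hj)

theorem map_eq_zero_iff_of_sign {Q : R[X]} {t t' : R →+* ℝ}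
    (h : ∀ i, SignType.sign (t (Q.coeff i)) = SignType.sign (t' (Q.coeff i))) :
    Q.map t = 0 ↔ Q.map t' = 0 := by
  simp only [Polynomial.ext_iff, coeff_map, coeff_zero]
  exact forall_congr' fun i => by rw [← sign_eq_zero_iff, h i, sign_eq_zero_iff]

/-- The sign of `P` is known only at roots of members of `F`, through pseudo-remainders. The marks
are therefore first reduced to such roots. Every critical point of `P` remains marked because `F`
contains the derivative, and the root pairs of `P` can then be added. -/
theorem exists_partialIso_insert {P : R[X]} {G : Set R[X]} (hP : 0 < P.natDegree)
    {t t' : R →+* ℝ} (hl : t P.leadingCoeff ≠ 0)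
    (hPc : ∀ i, SignType.sign (t (P.coeff i)) = SignType.sign (t' (P.coeff i)))
    (hc : ∀ Q ∈ insert (derivative P) G, ∀ i,
      SignType.sign (t (Q.coeff i)) = SignType.sign (t' (Q.coeff i)))
    {T : Set (ℝ × ℝ)} (hT : IsPartialIso T)
    (hs : ∀ x y, SamePos T x y → ∀ Q ∈ pseudoRemFamily P (insert (derivative P) G),
      SignType.sign ((Q.map t).eval x) = SignType.sign ((Q.map t').eval y)) :
    ∃ T : Set (ℝ × ℝ), IsPartialIso T ∧ ∀ x y, SamePos T x y → ∀ Q ∈ insert P G,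
      SignType.sign ((Q.map t).eval x) = SignType.sign ((Q.map t').eval y) := by
  set F := insert (derivative P) G with hF
  have hs2 : ∀ x y, SamePos T x y → ∀ Q ∈ F,
      SignType.sign ((Q.map t).eval x) = SignType.sign ((Q.map t').eval y) :=
    fun x y hxy Q hQ => hs x y hxy Q (Or.inl hQ)
  set T₀ := {r ∈ T | ∃ Q ∈ F, Q.map t ≠ 0 ∧ (Q.map t).eval r.1 = 0} with hT₀
  have hsub : T₀ ⊆ T := sep_subset _ _
  have hs₀ : ∀ x y, SamePos T₀ x y → ∀ Q ∈ F,
      SignType.sign ((Q.map t).eval x) = SignType.sign ((Q.map t').eval y) :=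
    fun x y hxy Q hQ => sign_eq_of_samePos_roots (p := fun Q => Q.map t)
      (q := fun Q => Q.map t') hT hs2 (fun Q hQ => map_eq_zero_iff_of_sign (hc Q hQ)) hxy hQ
  have hdP : derivative P ∈ F := mem_insert _ _
  have hmarked : ∀ r ∈ T₀, SignType.sign ((P.map t).eval r.1) =
      SignType.sign ((P.map t').eval r.2) := by
    rintro r ⟨hr, Q, hQ, hQ0, hQr⟩
    have hpos := hT.samePos r hr
    have hQr' : (Q.map t').eval r.2 = 0 := by
      have := hs2 _ _ hpos Q hQ
      rwa [hQr, sign_zero, eq_comm, sign_eq_zero_iff] at this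
    have hk0 : 0 < (Q.map t).natDegree := by
      refine Nat.pos_of_ne_zero fun h => hQ0 ?_
      obtain ⟨c, hc⟩ := natDegree_eq_zero.1 h
      rw [← hc, eval_C] at hQr
      rw [← hc, hQr, C_0]
    -- Specialization may lower the degree of `Q`, so division is by the truncation at the actual
    -- degree. For this reason `pseudoRemFamily` runs over all truncations.
    rw [← sign_eval_pseudoRem_truncDegree P Q t rfl hk0 hQr,
      ← sign_eval_pseudoRem_truncDegree P Q t' (natDegree_map_eq (hc Q hQ)).symm hk0 hQr']
    refine hs _ _ hpos _ (Or.inr (mem_biUnion hQ ⟨_, ⟨hk0, natDegree_map_le⟩, rfl⟩))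
  have hdeg : (P.map t).natDegree = P.natDegree := natDegree_map_of_leadingCoeff_ne_zero t hl
  have hdeg' : (P.map t').natDegree = P.natDegree := by rw [← hdeg, natDegree_map_eq hPc]
  have hlead : SignType.sign (P.map t).leadingCoeff = SignType.sign (P.map t').leadingCoeff := by
    rw [leadingCoeff, leadingCoeff, hdeg, hdeg', coeff_map, coeff_map, hPc]
  have hne : derivative (P.map t) ≠ 0 := fun h => by
    have := derivative_eq_zero.1 h
    lia
  have hext : SignExtendable T₀ (P.map t) (P.map t') :=
    { iso := hT.subset hsub
      derivative_ne_zero := hne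
      derivative_ne_zero' := fun h => by
        have := derivative_eq_zero.1 h
        lia
      derivative := fun x y hxy => by
        rw [derivative_map, derivative_map]; exact hs₀ x y hxy _ hdP
      critical := fun x y hxy h0 => hmarked (x, y)
        (mem_of_samePos_of_root (s := F) (p := fun Q => Q.map t) (q := fun Q => Q.map t')
          (hT.subset hsub).finite hs₀ hdP (by rwa [← derivative_map])
          (by rwa [← derivative_map]) hxy)
      marked := hmarked
      atBot := ⟨_, eventually_sign_eval_atBot _, by
        rw [hlead, hdeg, ← hdeg']; exact eventually_sign_eval_atBot _⟩
      atTop := ⟨_, eventually_sign_eval_atTop _, by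
        rw [hlead]; exact eventually_sign_eval_atTop _⟩ }
  refine ⟨_, hext.isPartialIso, fun x y hxy Q hQ => ?_⟩
  rcases hQ with rfl | hQ
  · exact hext.sign_eq hxy
  · exact hs₀ x y (hxy.mono subset_union_left) Q (mem_insert_of_mem _ hQ)

/-- If the leading coefficient of `P` specializes to zero, `P` may be replaced by `P.eraseLead`.
Otherwise the derivative and the pseudo-remainders decide. The coefficients added to the test set
tell the two cases apart and fix the degrees after specialization. -/
theorem SignDetermined.insert_of_natDegree_pos {P : R[X]} {G : Set R[X]} (hG : G.Finite)
    (hP : 0 < P.natDegree) (h₀ : SignDetermined (insert P.eraseLead G))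
    (h₁ : SignDetermined (pseudoRemFamily P (insert (derivative P) G))) :
    SignDetermined (insert P G) := by
  obtain ⟨C₀, hC₀, h₀⟩ := h₀
  obtain ⟨C₁, hC₁, h₁⟩ := h₁
  have hFfin : (insert P (insert (derivative P) G)).Finite := (hG.insert _).insert _
  refine ⟨C₀ ∪ C₁ ∪ ⋃ Q ∈ insert P (insert (derivative P) G), Q.coeff '' Iic Q.natDegree,
    (hC₀.union hC₁).union (hFfin.biUnion fun Q _ => (finite_Iic _).image _), fun t t' ht => ?_⟩
  have hcoeff : ∀ Q ∈ insert P (insert (derivative P) G), ∀ i,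
      SignType.sign (t (Q.coeff i)) = SignType.sign (t' (Q.coeff i)) := fun Q hQ i => by
    by_cases hi : i ≤ Q.natDegree
    · exact ht _ (Or.inr (mem_biUnion hQ ⟨i, hi, rfl⟩))
    · rw [coeff_eq_zero_of_natDegree_lt (by lia)]; simp
  by_cases hl : t P.leadingCoeff = 0
  · obtain ⟨T, hT, hs⟩ := h₀ t t' fun c hc => ht c (Or.inl (Or.inl hc))
    refine ⟨T, hT, fun x y hxy Q hQ => ?_⟩
    rcases hQ with rfl | hQ
    · have key : ∀ t : R →+* ℝ, t Q.leadingCoeff = 0 → Q.map t = Q.eraseLead.map t := by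
        intro t ht
        conv_lhs => rw [← Q.eraseLead_add_monomial_natDegree_leadingCoeff]
        rw [Polynomial.map_add, map_monomial, ht]; simp
      have hl' : t' Q.leadingCoeff = 0 := by
        have := hcoeff Q (mem_insert _ _) Q.natDegree
        rwa [coeff_natDegree, hl, sign_zero, eq_comm, sign_eq_zero_iff] at this
      rw [key t hl, key t' hl']
      exact hs x y hxy _ (mem_insert _ _)
    · exact hs x y hxy Q (mem_insert_of_mem _ hQ)
  · obtain ⟨T, hT, hs⟩ := h₁ t t' fun c hc => ht c (Or.inl (Or.inr hc))
    exact exists_partialIso_insert hP hl (hcoeff P (mem_insert _ _))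
      (fun Q hQ => hcoeff Q (mem_insert_of_mem _ hQ)) hT hs

theorem finite_pseudoRemFamily {P : R[X]} {G : Set R[X]} (hG : G.Finite) :
    (pseudoRemFamily P G).Finite :=
  hG.union (hG.biUnion fun _ _ => (finite_Icc _ _).image _)

/-- Induction on a degree bound and, inside it, on the number of members of top degree `d`. Removing
one such member costs only finitely many new polynomials of degree less than `d`, so the other
members in `H` are the only ones of degree `d` left. -/
theorem signDetermined_of_finite {F : Set R[X]} (hF : F.Finite) : SignDetermined F := by
  obtain ⟨d, hd⟩ : ∃ d, ∀ P ∈ F, P.natDegree < d := by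
    obtain ⟨d, hd⟩ := (hF.image natDegree).bddAbove
    exact ⟨d + 1, fun P hP => Nat.lt_succ_of_le (hd ⟨P, hP, rfl⟩)⟩
  induction d generalizing F with
  | zero =>
    rw [eq_empty_of_forall_notMem fun P hP => Nat.not_lt_zero _ (hd P hP)]
    exact signDetermined_empty
  | succ d ih =>
    suffices h : ∀ H : Set R[X], H.Finite → (∀ P ∈ H, P.natDegree = d) →
        ∀ G : Set R[X], G.Finite → (∀ P ∈ G, P.natDegree < d) → SignDetermined (H ∪ G) by
      have := h {P ∈ F | P.natDegree = d} (hF.subset (sep_subset _ _)) (fun P hP => hP.2)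
        {P ∈ F | P.natDegree < d} (hF.subset (sep_subset _ _)) (fun P hP => hP.2)
      convert this using 1
      ext P
      simp only [mem_union, mem_sep_iff]
      constructor
      · intro hP
        have := hd P hP
        by_cases h : P.natDegree = d
        · exact Or.inl ⟨hP, h⟩
        · exact Or.inr ⟨hP, by lia⟩
      · rintro (h | h) <;> exact h.1
    intro H hH
    induction H, hH using Set.Finite.induction_on with
    | empty =>
      intro _ G hG hGd
      rw [empty_union]
      exact ih hG hGd
    | @insert P H hPH hH ihH =>
      intro hHd G hG hGd
      have hPd := hHd P (mem_insert _ _)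
      have ihH := ihH fun Q hQ => hHd Q (mem_insert_of_mem _ hQ)
      rw [insert_union]
      rcases Nat.eq_zero_or_pos d with h0 | h0
      · exact (ihH G hG hGd).insert_const (by lia)
      refine SignDetermined.insert_of_natDegree_pos (hH.union hG) (by lia) ?_ ?_
      · rw [← union_insert]
        refine ihH _ (hG.insert _) ?_
        rintro Q (rfl | hQ)
        · have := P.eraseLead_natDegree_le
          lia
        · exact hGd Q hQ
      -- Members of `H` are taken out of the lower-degree part, since they still have degree `d` and
      -- are covered by the inner induction. Every other member has degree less than `d`.
      · have hfin : (pseudoRemFamily P (insert (derivative P) (H ∪ G)) \ H).Finite :=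
          (finite_pseudoRemFamily ((hH.union hG).insert _)).sdiff
        have := ihH _ hfin ?_
        · convert this using 1
          rw [union_sdiff_cancel]
          exact subset_union_of_subset_left (subset_union_left.trans (subset_insert _ _)) _
        · have hder : (derivative P).natDegree < d := by
            have := natDegree_derivative_lt (p := P) (by lia)
            lia
          have hle : ∀ Q ∈ insert (derivative P) (H ∪ G), Q.natDegree ≤ d := by
            rintro Q (rfl | hQ | hQ)
            · exact hder.le
            · exact (hHd Q (mem_insert_of_mem _ hQ)).le
            · exact (hGd Q hQ).le
          rintro Q ⟨hQ | hQ, hQH⟩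
          · rcases hQ with rfl | hQ | hQ
            · exact hder
            · exact absurd hQ hQH
            · exact hGd Q hQ
          · obtain ⟨Q', hQ', k, hk, rfl⟩ := mem_iUnion₂.1 hQ
            have h1 := hle Q' hQ'
            have h2 := natDegree_pseudoRem_le P (truncDegree k Q')
            have h3 := natDegree_truncDegree_le k Q'
            have h4 := hk.2
            simp only
            lia

end SignDetermined

/-! ### Polynomial maps and semialgebraic sets -/

section Semialgebraic

variable {E : Type*} [NormedAddCommGroup E] [NormedSpace ℝ E]
  {F : Type*} [NormedAddCommGroup F] [NormedSpace ℝ F]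
  {G : Type*} [NormedAddCommGroup G] [NormedSpace ℝ G]

theorem const_mem_realPolyFunctions (c : ℝ) : (fun _ : E => c) ∈ realPolyFunctions E :=
  (realPolyFunctions E).algebraMap_mem c

theorem linear_mem_realPolyFunctions (l : E →ₗ[ℝ] ℝ) : (fun x => l x) ∈ realPolyFunctions E :=
  Algebra.subset_adjoin ⟨l, rfl⟩

theorem realPolyFunctions_induction {P : (p : E → ℝ) → p ∈ realPolyFunctions E → Prop}
    (linear : ∀ l : E →ₗ[ℝ] ℝ, P (fun x => l x) (linear_mem_realPolyFunctions l))
    (const : ∀ c : ℝ, P (fun _ => c) (const_mem_realPolyFunctions c))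
    (add : ∀ f g hf hg, P f hf → P g hg → P (f + g) (add_mem hf hg))
    (mul : ∀ f g hf hg, P f hf → P g hg → P (f * g) (mul_mem hf hg))
    {p : E → ℝ} (hp : p ∈ realPolyFunctions E) : P p hp := by
  induction hp using Algebra.adjoin_induction with
  | mem x hx => obtain ⟨l, rfl⟩ := hx; exact linear l
  | algebraMap r => exact const r
  | add x y hx hy h h' => exact add x y hx hy h h'
  | mul x y hx hy h h' => exact mul x y hx hy h h'

/-- Maps all of whose components are polynomial functions. -/
def IsPolyMap (φ : E → F) : Prop :=
  ∀ l : F →ₗ[ℝ] ℝ, (fun x => l (φ x)) ∈ realPolyFunctions E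

theorem IsPolyMap.comp_mem {φ : E → F} (hφ : IsPolyMap φ) {p : F → ℝ}
    (hp : p ∈ realPolyFunctions F) : (fun x => p (φ x)) ∈ realPolyFunctions E := by
  induction hp using realPolyFunctions_induction with
  | linear l => exact hφ l
  | const c => exact const_mem_realPolyFunctions c
  | add f g _ _ hf hg => exact (realPolyFunctions E).add_mem hf hg
  | mul f g _ _ hf hg => exact (realPolyFunctions E).mul_mem hf hg

theorem isPolyMap_real {f : E → ℝ} : IsPolyMap f ↔ f ∈ realPolyFunctions E := by
  refine ⟨fun h => h LinearMap.id, fun h l => ?_⟩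
  have : (fun x => l (f x)) = (fun _ => l 1) * f := by
    funext x
    rw [Pi.mul_apply, mul_comm, ← smul_eq_mul, ← l.map_smul, smul_eq_mul, mul_one]
  rw [this]
  exact (realPolyFunctions E).mul_mem (const_mem_realPolyFunctions _) h

theorem IsPolyMap.comp {φ : F → G} {ψ : E → F} (hφ : IsPolyMap φ) (hψ : IsPolyMap ψ) :
    IsPolyMap fun x => φ (ψ x) :=
  fun l => hψ.comp_mem (hφ l)

theorem LinearMap.isPolyMap (φ : E →ₗ[ℝ] F) : IsPolyMap φ :=
  fun l => linear_mem_realPolyFunctions (l ∘ₗ φ)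

theorem isPolyMap_const (c : F) : IsPolyMap fun _ : E => c :=
  fun l => const_mem_realPolyFunctions (l c)

theorem isPolyMap_id : IsPolyMap fun x : E => x :=
  (LinearMap.id : E →ₗ[ℝ] E).isPolyMap

theorem IsPolyMap.fst {φ : E → F × G} (h : IsPolyMap φ) : IsPolyMap fun x => (φ x).1 :=
  (LinearMap.fst ℝ F G).isPolyMap.comp h

theorem IsPolyMap.snd {φ : E → F × G} (h : IsPolyMap φ) : IsPolyMap fun x => (φ x).2 :=
  (LinearMap.snd ℝ F G).isPolyMap.comp h

theorem IsPolyMap.sub {φ ψ : E → F} (hφ : IsPolyMap φ) (hψ : IsPolyMap ψ) :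
    IsPolyMap fun x => φ x - ψ x := fun l => by
  simp only [map_sub]
  exact (realPolyFunctions E).sub_mem (hφ l) (hψ l)

theorem IsPolyMap.smul {f : E → ℝ} {φ : E → F} (hf : IsPolyMap f) (hφ : IsPolyMap φ) :
    IsPolyMap fun x => f x • φ x := fun l => by
  simp only [map_smul]
  exact (realPolyFunctions E).mul_mem (isPolyMap_real.1 hf) (hφ l)

theorem IsPolyMap.prodMk {φ : E → F} {ψ : E → G} (hφ : IsPolyMap φ) (hψ : IsPolyMap ψ) :
    IsPolyMap fun x => (φ x, ψ x) := fun l => by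
  have := (realPolyFunctions E).add_mem (hφ (l ∘ₗ LinearMap.inl ℝ F G))
    (hψ (l ∘ₗ LinearMap.inr ℝ F G))
  convert this using 1
  funext x
  simp [← map_add]

theorem IsPolyMap.finsetSum {ι : Type*} (s : Finset ι) {φ : ι → E → F}
    (h : ∀ i ∈ s, IsPolyMap (φ i)) : IsPolyMap fun x => ∑ i ∈ s, φ i x := fun l => by
  have := (realPolyFunctions E).sum_mem fun i hi => h i hi l
  convert this using 1
  funext x
  simp

theorem isPolyMap_pi {k : ℕ} {φ : E → Fin k → ℝ} (h : ∀ i, IsPolyMap fun x => φ x i) :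
    IsPolyMap φ := by
  have : φ = fun x => ∑ i, φ x i • (Pi.single i 1 : Fin k → ℝ) := by
    funext x; exact pi_eq_sum_univ' (φ x)
  rw [this]
  exact IsPolyMap.finsetSum _ fun i _ => (h i).smul (isPolyMap_const _)

/-! ### Logical operations on semialgebraic conditions. -/

theorem isSemialgebraic_lt {f g : E → ℝ} (hf : IsPolyMap f) (hg : IsPolyMap g) :
    IsSemialgebraic {x | f x < g x} := by
  have := IsSemialgebraic.pos _ (isPolyMap_real.1 (hg.sub hf))
  simpa using this

theorem IsSemialgebraic.preimage {s : Set F} (hs : IsSemialgebraic s) {φ : E → F}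
    (hφ : IsPolyMap φ) : IsSemialgebraic (φ ⁻¹' s) := by
  induction hs with
  | pos p hp => exact IsSemialgebraic.pos _ (hφ.comp_mem hp)
  | compl s _ ih => exact ih.compl
  | union s t _ _ ihs iht => exact ihs.union _ _ iht

theorem IsSemialgebraic.or {P Q : E → Prop} (hP : IsSemialgebraic {x | P x})
    (hQ : IsSemialgebraic {x | Q x}) : IsSemialgebraic {x | P x ∨ Q x} :=
  hP.union _ _ hQ

theorem IsSemialgebraic.not {P : E → Prop} (hP : IsSemialgebraic {x | P x}) :
    IsSemialgebraic {x | ¬ P x} :=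
  hP.compl

theorem IsSemialgebraic.and {P Q : E → Prop} (hP : IsSemialgebraic {x | P x})
    (hQ : IsSemialgebraic {x | Q x}) : IsSemialgebraic {x | P x ∧ Q x} := by
  have := (hP.not.or hQ.not).not
  simpa only [not_or, not_not] using this

theorem IsSemialgebraic.imp {P Q : E → Prop} (hP : IsSemialgebraic {x | P x})
    (hQ : IsSemialgebraic {x | Q x}) : IsSemialgebraic {x | P x → Q x} := by
  have := hP.not.or hQ
  simpa only [← imp_iff_not_or] using this

theorem IsSemialgebraic.inter {s t : Set E} (hs : IsSemialgebraic s) (ht : IsSemialgebraic t) :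
    IsSemialgebraic (s ∩ t) :=
  IsSemialgebraic.and hs ht

theorem isSemialgebraic_univ : IsSemialgebraic (univ : Set E) := by
  simpa using IsSemialgebraic.pos _ (const_mem_realPolyFunctions (E := E) 1)

theorem isSemialgebraic_eq_zero {f : E → ℝ} (hf : IsPolyMap f) :
    IsSemialgebraic {x | f x = 0} := by
  have h := ((isSemialgebraic_lt hf (isPolyMap_const 0)).or
    (isSemialgebraic_lt (isPolyMap_const 0) hf)).not
  convert h using 3 with x
  rw [← lt_or_lt_iff_ne.not_left]

theorem IsSemialgebraic.biInter {ι : Type*} {I : Set ι} (hI : I.Finite) {s : ι → Set E}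
    (h : ∀ i ∈ I, IsSemialgebraic (s i)) : IsSemialgebraic (⋂ i ∈ I, s i) := by
  induction I, hI using Set.Finite.induction_on with
  | empty => simpa using isSemialgebraic_univ
  | insert _ _ ih =>
    rw [biInter_insert]
    exact (h _ (mem_insert _ _)).inter (ih fun i hi => h i (mem_insert_of_mem _ hi))

theorem IsSemialgebraic.biUnion {ι : Type*} {I : Set ι} (hI : I.Finite) {s : ι → Set E}
    (h : ∀ i ∈ I, IsSemialgebraic (s i)) : IsSemialgebraic (⋃ i ∈ I, s i) := by
  have := (IsSemialgebraic.biInter hI fun i hi => (h i hi).compl).compl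
  simpa using this

/-- Membership in `s` is determined by the signs of the polynomial functions in `C`. -/
def DeterminedBySigns (C : Set (E → ℝ)) (s : Set E) : Prop :=
  ∀ x y, (∀ p ∈ C, SignType.sign (p x) = SignType.sign (p y)) → x ∈ s → y ∈ s

theorem IsSemialgebraic.exists_determinedBySigns {s : Set E} (hs : IsSemialgebraic s) :
    ∃ C : Set (E → ℝ), C.Finite ∧ C ⊆ realPolyFunctions E ∧ DeterminedBySigns C s := by
  induction hs with
  | pos p hp =>
    refine ⟨{p}, finite_singleton p, by simpa using hp, fun x y h hx => ?_⟩
    have := h p rfl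
    rw [mem_ofPred_eq, ← sign_eq_one_iff] at hx ⊢
    rw [← this, hx]
  | compl s _ ih =>
    obtain ⟨C, h1, h2, h3⟩ := ih
    exact ⟨C, h1, h2, fun x y h hx hy => hx (h3 y x (fun p hp => (h p hp).symm) hy)⟩
  | union s t _ _ ihs iht =>
    obtain ⟨C, h1, h2, h3⟩ := ihs
    obtain ⟨D, h4, h5, h6⟩ := iht
    refine ⟨C ∪ D, h1.union h4, union_subset h2 h5, fun x y h hx => ?_⟩
    rcases hx with hx | hx
    · exact Or.inl (h3 x y (fun p hp => h p (Or.inl hp)) hx)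
    · exact Or.inr (h6 x y (fun p hp => h p (Or.inr hp)) hx)

theorem isSemialgebraic_sign_eq {p : E → ℝ} (hp : p ∈ realPolyFunctions E) (σ : SignType) :
    IsSemialgebraic {x | SignType.sign (p x) = σ} := by
  have hp := isPolyMap_real.2 hp
  cases σ
  · simpa only [SignType.zero_eq_zero, sign_eq_zero_iff] using isSemialgebraic_eq_zero hp
  · simpa only [SignType.neg_eq_neg_one, sign_eq_neg_one_iff] using
      isSemialgebraic_lt hp (isPolyMap_const 0)
  · simpa only [SignType.pos_eq_one, sign_eq_one_iff] using
      isSemialgebraic_lt (isPolyMap_const 0) hp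

/-- The set is the union of the sign conditions realized on it, and only finitely many sign vectors
exist. -/
theorem DeterminedBySigns.isSemialgebraic {s : Set E} {C : Set (E → ℝ)} (hC : C.Finite)
    (hCp : C ⊆ realPolyFunctions E) (hs : DeterminedBySigns C s) : IsSemialgebraic s := by
  have : Finite C := hC
  let σ : E → C → SignType := fun x p => SignType.sign (p.1 x)
  have : s = ⋃ τ ∈ σ '' s, ⋂ p ∈ (univ : Set C), {x | SignType.sign (p.1 x) = τ p} := by
    ext y
    simp only [mem_iUnion, mem_iInter, mem_ofPred_eq, exists_prop, mem_image, mem_univ,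
      forall_true_left]
    constructor
    · exact fun hy => ⟨σ y, ⟨y, hy, rfl⟩, fun _ => rfl⟩
    · rintro ⟨_, ⟨x, hx, rfl⟩, h⟩
      exact hs x y (fun p hp => (h ⟨p, hp⟩).symm) hx
  rw [this]
  exact IsSemialgebraic.biUnion (Set.toFinite _) fun τ _ => IsSemialgebraic.biInter
    (Set.toFinite _) fun p _ => isSemialgebraic_sign_eq (hCp p.2) _

/-! ### Projections of semialgebraic sets -/

/-- Evaluation of polynomial functions at a point. -/
def polyEval (x : E) : realPolyFunctions E →+* ℝ :=
  (Pi.evalRingHom (fun _ : E => ℝ) x).comp (realPolyFunctions E).toSubring.subtype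

theorem exists_polynomial_of_mem {p : E × ℝ → ℝ} (hp : p ∈ realPolyFunctions (E × ℝ)) :
    ∃ P : Polynomial (realPolyFunctions E),
      ∀ x r, p (x, r) = (P.map (polyEval x)).eval r := by
  induction hp using realPolyFunctions_induction with
  | linear l =>
    refine ⟨Polynomial.C ⟨_, linear_mem_realPolyFunctions (l ∘ₗ LinearMap.inl ℝ E ℝ)⟩ +
      Polynomial.C ⟨_, const_mem_realPolyFunctions (l (0, 1))⟩ * Polynomial.X, fun x r => ?_⟩
    have : (x, r) = (x, (0 : ℝ)) + r • ((0 : E), (1 : ℝ)) := by simp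
    have h : l (x, r) = l (x, 0) + r * l (0, 1) := by
      rw [this, map_add, map_smul, smul_eq_mul]
    simp [polyEval, h, mul_comm r]
  | const c => exact ⟨Polynomial.C ⟨_, const_mem_realPolyFunctions c⟩, by simp [polyEval]⟩
  | add f g _ _ hf hg =>
    obtain ⟨P, hP⟩ := hf
    obtain ⟨Q, hQ⟩ := hg
    exact ⟨P + Q, fun x r => by simp [hP, hQ]⟩
  | mul f g _ _ hf hg =>
    obtain ⟨P, hP⟩ := hf
    obtain ⟨Q, hQ⟩ := hg
    exact ⟨P * Q, fun x r => by simp [hP, hQ]⟩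

/-- The polynomials defining `s` are read as univariate polynomials with coefficients that are
functions on the base. Two base points with equal signs of the relevant coefficients have matching
sign diagrams in their fibres, so nonemptiness of the fibre depends only on finitely many signs. -/
theorem IsSemialgebraic.exists_real {s : Set (E × ℝ)} (hs : IsSemialgebraic s) :
    IsSemialgebraic {x | ∃ r, (x, r) ∈ s} := by
  obtain ⟨C, hC, hCp, hCs⟩ := hs.exists_determinedBySigns
  choose! P hP using fun p (hp : p ∈ C) => exists_polynomial_of_mem (hCp hp)
  obtain ⟨D, hD, hDs⟩ := signDetermined_of_finite (hC.image P)
  refine DeterminedBySigns.isSemialgebraic (C := Subtype.val '' D) (hD.image _)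
    (by rintro _ ⟨d, _, rfl⟩; exact d.2) fun x y hxy => ?_
  rintro ⟨r, hr⟩
  obtain ⟨T, hT, hTs⟩ := hDs (polyEval x) (polyEval y) fun c hc => hxy _ ⟨c, hc, rfl⟩
  obtain ⟨r', hr'⟩ := hT.exists_samePos r
  refine ⟨r', hCs (x, r) (y, r') (fun p hp => ?_) hr⟩
  rw [hP p hp, hP p hp]
  exact hTs r r' hr' _ ⟨p, hp, rfl⟩

theorem IsSemialgebraic.exists_pi {k : ℕ} {E : Type*} [NormedAddCommGroup E] [NormedSpace ℝ E]
    {s : Set (E × (Fin k → ℝ))} (hs : IsSemialgebraic s) :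
    IsSemialgebraic {x | ∃ r, (x, r) ∈ s} := by
  induction k generalizing E with
  | zero =>
    have := hs.preimage (φ := fun x : E => (x, (0 : Fin 0 → ℝ)))
      (isPolyMap_id.prodMk (isPolyMap_const _))
    convert this using 1
    ext x
    exact ⟨fun ⟨r, hr⟩ => by rwa [Subsingleton.elim r 0] at hr, fun h => ⟨0, h⟩⟩
  | succ k ih =>
    have h1 := hs.preimage (φ := fun z : (E × ℝ) × (Fin k → ℝ) =>
      (z.1.1, (Fin.cons z.1.2 z.2 : Fin (k + 1) → ℝ)))
      (isPolyMap_id.fst.fst.prodMk (isPolyMap_pi fun i => by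
        refine Fin.cases ?_ (fun i => ?_) i
        · simpa using isPolyMap_id.fst.snd
        · simpa using (LinearMap.proj (R := ℝ) (φ := fun _ : Fin k => ℝ) i).isPolyMap.comp
            isPolyMap_id.snd))
    convert (ih h1).exists_real using 1
    ext x
    simp only [mem_ofPred_eq, mem_preimage]
    exact Fin.exists_fin_succ_pi (P := fun r => (x, r) ∈ s)

/-- The **Tarski–Seidenberg theorem**: a projection of a semialgebraic set is semialgebraic. -/
theorem IsSemialgebraic.exists [FiniteDimensional ℝ F] {s : Set (E × F)}
    (hs : IsSemialgebraic s) : IsSemialgebraic {x | ∃ y, (x, y) ∈ s} := by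
  let e := (Module.finBasis ℝ F).equivFun
  have h1 := hs.preimage (φ := fun z : E × (Fin (Module.finrank ℝ F) → ℝ) => (z.1, e.symm z.2))
    (isPolyMap_id.fst.prodMk (e.symm.toLinearMap.isPolyMap.comp isPolyMap_id.snd))
  convert h1.exists_pi using 1
  ext x
  simp only [mem_ofPred_eq, mem_preimage]
  exact e.symm.surjective.exists

theorem IsSemialgebraic.forall [FiniteDimensional ℝ F] {s : Set (E × F)}
    (hs : IsSemialgebraic s) : IsSemialgebraic {x | ∀ y, (x, y) ∈ s} := by
  have := hs.compl.exists.compl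
  convert this using 1
  ext x
  simp

/-! ### Semialgebraic sets with empty interior -/

theorem continuous_of_mem_realPolyFunctions [FiniteDimensional ℝ E] {p : E → ℝ}
    (hp : p ∈ realPolyFunctions E) : Continuous p := by
  induction hp using realPolyFunctions_induction with
  | linear l => exact l.continuous_of_finiteDimensional
  | const c => exact continuous_const
  | add f g _ _ hf hg => exact hf.add hg
  | mul f g _ _ hf hg => exact hf.mul hg

theorem exists_polynomial_line {p : E → ℝ} (hp : p ∈ realPolyFunctions E) (a b : E) :
    ∃ P : Polynomial ℝ, ∀ r : ℝ, p (a + r • b) = P.eval r := by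
  induction hp using realPolyFunctions_induction with
  | linear l =>
    exact ⟨Polynomial.C (l a) + Polynomial.C (l b) * Polynomial.X, fun r => by
      simp [mul_comm r]⟩
  | const c => exact ⟨Polynomial.C c, by simp⟩
  | add f g _ _ hf hg =>
    obtain ⟨P, hP⟩ := hf
    obtain ⟨Q, hQ⟩ := hg
    exact ⟨P + Q, fun x => by simp [hP, hQ]⟩
  | mul f g _ _ hf hg =>
    obtain ⟨P, hP⟩ := hf
    obtain ⟨Q, hQ⟩ := hg
    exact ⟨P * Q, fun x => by simp [hP, hQ]⟩

/-- On the line from `a` to a point where `p` does not vanish, `p` is a nonzero univariate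
polynomial with finitely many roots. -/
theorem dense_ne_zero_of_mem_realPolyFunctions {p : E → ℝ} (hp : p ∈ realPolyFunctions E)
    (h0 : p ≠ 0) : Dense {x | p x ≠ 0} := by
  obtain ⟨b, hb⟩ := Function.ne_iff.1 h0
  intro a
  obtain ⟨P, hP⟩ := exists_polynomial_line hp a (b - a)
  have hP0 : P ≠ 0 := by
    rintro rfl
    have := hP 1
    simp at this
    exact hb this
  have h1 : ∀ᶠ r in 𝓝[≠] (0 : ℝ), p (a + r • (b - a)) ≠ 0 := by
    have hfin : {r | P.IsRoot r}.Finite := Polynomial.finite_setOfPred_isRoot hP0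
    have h2 : ∀ᶠ r in 𝓝[≠] (0 : ℝ), r ∉ {r | P.IsRoot r} \ {0} := nhdsWithin_le_nhds
      ((hfin.subset sdiff_subset).isClosed.isOpen_compl.mem_nhds (by simp))
    filter_upwards [h2, self_mem_nhdsWithin] with r hr hr0
    rw [hP]
    exact fun h => hr ⟨h, hr0⟩
  have h3 : Tendsto (fun r : ℝ => a + r • (b - a)) (𝓝[≠] 0) (𝓝 a) := by
    have : ContinuousAt (fun r : ℝ => a + r • (b - a)) 0 := by fun_prop
    simpa [ContinuousAt] using this.mono_left nhdsWithin_le_nhds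
  exact mem_closure_of_tendsto h3 h1

/-- Both functions are nonzero polynomials on the line joining a nonzero of one to a nonzero of the
other. -/
theorem realPolyFunctions_mul_ne_zero {p q : E → ℝ} (hp : p ∈ realPolyFunctions E)
    (hq : q ∈ realPolyFunctions E) (hp0 : p ≠ 0) (hq0 : q ≠ 0) : p * q ≠ 0 := by
  obtain ⟨b, hb⟩ := Function.ne_iff.1 hp0
  obtain ⟨c, hc⟩ := Function.ne_iff.1 hq0
  obtain ⟨P, hP⟩ := exists_polynomial_line hp b (c - b)
  obtain ⟨Q, hQ⟩ := exists_polynomial_line hq b (c - b)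
  have hP0 : P ≠ 0 := by
    rintro rfl
    have := hP 0
    simp at this
    exact hb this
  have hQ0 : Q ≠ 0 := by
    rintro rfl
    have := hQ 1
    simp at this
    exact hc this
  intro h
  refine mul_ne_zero hP0 hQ0 (Polynomial.funext fun r => ?_)
  have := congrFun h (b + r • (c - b))
  rw [Pi.mul_apply, hP, hQ] at this
  simpa using this

theorem exists_poly_of_finite {C : Set (E → ℝ)} (hC : C.Finite) (hCp : C ⊆ realPolyFunctions E)
    (h0 : ∀ p ∈ C, p ≠ 0) :
    ∃ q ∈ realPolyFunctions E, q ≠ 0 ∧ ∀ p ∈ C, ∀ x, p x = 0 → q x = 0 := by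
  induction C, hC using Set.Finite.induction_on with
  | empty => exact ⟨1, one_mem _, one_ne_zero, by simp⟩
  | @insert p C _ _ ih =>
    obtain ⟨q, hq, hq0, h⟩ := ih ((subset_insert _ _).trans hCp)
      fun p hp => h0 p (mem_insert_of_mem _ hp)
    refine ⟨p * q, mul_mem (hCp (mem_insert _ _)) hq, realPolyFunctions_mul_ne_zero
      (hCp (mem_insert _ _)) hq (h0 p (mem_insert _ _)) hq0, ?_⟩
    rintro p' (rfl | hp') x hx
    · simp [hx]
    · simp [h p' hp' x hx]

/-- A semialgebraic set minus its interior is contained in a proper algebraic set. -/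
theorem IsSemialgebraic.exists_poly_of_notMem_interior [FiniteDimensional ℝ E] {s : Set E}
    (hs : IsSemialgebraic s) :
    ∃ q ∈ realPolyFunctions E, q ≠ 0 ∧ ∀ x ∈ s, x ∉ interior s → q x = 0 := by
  obtain ⟨C, hC, hCp, hCs⟩ := hs.exists_determinedBySigns
  obtain ⟨q, hq, hq0, h⟩ := exists_poly_of_finite (hC.subset (sep_subset C fun p => p ≠ 0))
    ((sep_subset _ _).trans hCp) fun p hp => hp.2
  refine ⟨q, hq, hq0, fun x hx => ?_⟩
  contrapose!
  intro hqx
  have hne : ∀ p ∈ C, p ≠ 0 → p x ≠ 0 := fun p hp hp0 hpx => hqx (h p ⟨hp, hp0⟩ x hpx)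
  -- Off the zeros of the nonzero defining functions all signs are locally constant, so a point of
  -- `s` there is interior.
  have hev : ∀ᶠ y in 𝓝 x, ∀ p ∈ C, SignType.sign (p x) = SignType.sign (p y) := by
    refine (eventually_all_finite hC).2 fun p hp => ?_
    by_cases hp0 : p = 0
    · simp [hp0]
    have hcont := (continuous_of_mem_realPolyFunctions (hCp hp)).continuousAt (x := x)
    rcases (hne p hp hp0).lt_or_gt with hlt | hgt
    · filter_upwards [hcont.eventually_lt continuousAt_const hlt] with y hy
      rw [sign_neg hlt, sign_neg hy]
    · filter_upwards [continuousAt_const.eventually_lt hcont hgt] with y hy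
      rw [sign_pos hgt, sign_pos hy]
  exact mem_interior_iff_mem_nhds.2 (hev.mono fun y hy => hCs x y hy hx)

theorem IsSemialgebraic.isMeagre_diff_interior [FiniteDimensional ℝ E] {s : Set E}
    (hs : IsSemialgebraic s) : IsMeagre (s \ interior s) := by
  obtain ⟨q, hq, hq0, h⟩ := hs.exists_poly_of_notMem_interior
  have hcl : IsClosed {x | q x = 0} :=
    isClosed_eq (continuous_of_mem_realPolyFunctions hq) continuous_const
  have h1 : interior {x | q x = 0} = ∅ := by
    rw [interior_eq_empty_iff_dense_compl]
    exact dense_ne_zero_of_mem_realPolyFunctions hq hq0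
  have h2 : IsNowhereDense {x | q x = 0} := by rwa [IsNowhereDense, hcl.closure_eq]
  exact h2.isMeagre.mono fun x hx => h x hx.1 hx.2

end Semialgebraic

/-! ### Differentiable sections of semialgebraic families -/

section Sections

variable {E : Type*} [NormedAddCommGroup E] [NormedSpace ℝ E]

/-- The polynomial function on `E × ℝ` given by a polynomial over the polynomial functions
on `E`. -/
noncomputable def polyFun (P : Polynomial (realPolyFunctions E)) (z : E × ℝ) : ℝ :=
  (P.map (polyEval z.1)).eval z.2

theorem polyFun_mem (P : Polynomial (realPolyFunctions E)) :
    polyFun P ∈ realPolyFunctions (E × ℝ) := by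
  induction P using Polynomial.induction_on' with
  | add P Q hP hQ =>
    have : polyFun (P + Q) = polyFun P + polyFun Q := by funext z; simp [polyFun]
    rw [this]
    exact add_mem hP hQ
  | monomial n a =>
    have : polyFun (Polynomial.monomial n a) = (fun z => a.1 z.1) * (fun z => z.2) ^ n := by
      funext z; simp [polyFun, polyEval]
    rw [this]
    exact mul_mem (isPolyMap_id.fst.comp_mem a.2)
      (pow_mem (isPolyMap_real.1 isPolyMap_id.snd) n)

theorem polyFun_iterate_derivative (P : Polynomial (realPolyFunctions E)) (j : ℕ) (t : E)
    (r : ℝ) : polyFun (Polynomial.derivative^[j] P) (t, r) =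
      (Polynomial.derivative^[j] (P.map (polyEval t))).eval r := by
  rw [polyFun, Polynomial.iterate_derivative_map]

variable [FiniteDimensional ℝ E]
  {F : Type*} [NormedAddCommGroup F] [NormedSpace ℝ F] [FiniteDimensional ℝ F]

/-- The square of a Euclidean norm on a finite-dimensional space. -/
noncomputable def sqNorm (x : E) : ℝ := ‖toEuclidean x‖ ^ 2

theorem isPolyMap_sqNorm : IsPolyMap (sqNorm : E → ℝ) := by
  have : (sqNorm : E → ℝ) = fun x => ∑ i, toEuclidean x i • toEuclidean x i := by
    funext x
    rw [sqNorm, EuclideanSpace.norm_sq_eq]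
    simp [sq]
  rw [this]
  have h : ∀ i, IsPolyMap fun x : E => toEuclidean x i := fun i =>
    ((EuclideanSpace.proj i : _ →L[ℝ] ℝ) ∘L
      (toEuclidean : E ≃L[ℝ] _).toContinuousLinearMap).toLinearMap.isPolyMap
  exact IsPolyMap.finsetSum _ fun i _ => (h i).smul (h i)

theorem continuous_sqNorm : Continuous (sqNorm : E → ℝ) :=
  (toEuclidean.continuous.norm).pow 2

@[simp] theorem sqNorm_zero : sqNorm (0 : E) = 0 := by simp [sqNorm]

theorem exists_sqNorm_lt_subset {x : E} {V : Set E} (hV : V ∈ 𝓝 x) :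
    ∃ ε > 0, ∀ y, sqNorm (y - x) < ε → y ∈ V := by
  obtain ⟨ε, hε, h⟩ := Euclidean.nhds_basis_ball.mem_iff.1 hV
  refine ⟨ε ^ 2, by positivity, fun y hy => h ?_⟩
  rw [sqNorm, map_sub] at hy
  have := lt_of_pow_lt_pow_left₀ 2 hε.le hy
  rwa [← dist_eq_norm] at this

/-- Euclidean balls are used because the balls of the given norm need not be semialgebraic. -/
theorem exists_semialgebraic_nhds {x : E} {V : Set E} (hV : V ∈ 𝓝 x) :
    ∃ W ⊆ V, x ∈ W ∧ IsOpen W ∧ IsSemialgebraic W := by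
  obtain ⟨ε, hε, h⟩ := exists_sqNorm_lt_subset hV
  refine ⟨{y | sqNorm (y - x) < ε}, h, by simpa using hε,
    isOpen_lt (continuous_sqNorm.comp (continuous_id.sub continuous_const)) continuous_const, ?_⟩
  exact isSemialgebraic_lt (isPolyMap_sqNorm.comp (isPolyMap_id.sub (isPolyMap_const x)))
    (isPolyMap_const ε)

/-- Baire's theorem: if no interior met `V`, then `V` would be covered by the countably many meagre
sets `s i \ interior (s i)`. -/
theorem exists_interior_of_countable_cover {ι : Type*} [Countable ι] {s : ι → Set E}
    (hs : ∀ i, IsSemialgebraic (s i)) {V : Set E} (hV : IsOpen V) (hne : V.Nonempty)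
    (hVs : V ⊆ ⋃ i, s i) : ∃ i, (interior (s i) ∩ V).Nonempty := by
  have : CompleteSpace E := FiniteDimensional.complete ℝ E
  by_contra! h
  refine not_isMeagre_of_isOpen hV hne ((isMeagre_iUnion fun i =>
    (hs i).isMeagre_diff_interior).mono fun x hx => ?_)
  obtain ⟨i, hi⟩ := mem_iUnion.1 (hVs hx)
  exact mem_iUnion.2 ⟨i, hi, fun hx' => (h i).subset ⟨hx', hx⟩⟩

theorem contDiff_of_mem_realPolyFunctions {p : E → ℝ} (hp : p ∈ realPolyFunctions E) :
    ContDiff ℝ 1 p := by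
  induction hp using realPolyFunctions_induction with
  | linear l => exact l.toContinuousLinearMap.contDiff
  | const c => exact contDiff_const
  | add f g _ _ hf hg => exact hf.add hg
  | mul f g _ _ hf hg => exact hf.mul hg

theorem fderiv_polyFun (P : Polynomial (realPolyFunctions E)) (z : E × ℝ) :
    fderiv ℝ (polyFun P) z (0, 1) = polyFun P.derivative z := by
  have h1 : HasFDerivAt (polyFun P) (fderiv ℝ (polyFun P) z) (z.1, z.2) :=
    ((contDiff_of_mem_realPolyFunctions (polyFun_mem P)).differentiable one_ne_zero z).hasFDerivAt
  have h2 : HasDerivAt (fun r : ℝ => (z.1, r)) (0, 1) z.2 :=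
    (hasDerivAt_const _ _).prodMk (hasDerivAt_id _)
  have h3 := h1.comp_hasDerivAt z.2 h2
  have h4 : HasDerivAt (polyFun P ∘ fun r : ℝ => (z.1, r)) (polyFun P.derivative z) z.2 := by
    have := (P.map (polyEval z.1)).hasDerivAt z.2
    rw [Polynomial.derivative_map] at this
    exact this
  exact h3.unique h4

theorem exists_implicit_nhds (P : Polynomial (realPolyFunctions E)) {z : E × ℝ}
    (hz : polyFun P z = 0) (hz' : polyFun P.derivative z ≠ 0) :
    ∃ (W : Set (E × ℝ)) (g : E → ℝ), W ∈ 𝓝 z ∧ IsSemialgebraic W ∧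
      ∀ w ∈ W, (polyFun P w = 0 → w.2 = g w.1) ∧ DifferentiableAt ℝ g w.1 := by
  have : CompleteSpace E := FiniteDimensional.complete ℝ E
  have hc : ContDiffAt ℝ 1 (polyFun P) z :=
    (contDiff_of_mem_realPolyFunctions (polyFun_mem P)).contDiffAt
  have hinv : (fderiv ℝ (polyFun P) z ∘L .inr ℝ E ℝ).IsInvertible := by
    refine ⟨ContinuousLinearEquiv.unitsEquivAut ℝ (Units.mk0 _ hz'), ?_⟩
    ext
    simp [fderiv_polyFun]
  set g := hc.implicitFunction one_ne_zero hinv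
  have h1 := hc.eventually_apply_eq_iff_implicitFunction one_ne_zero hinv
  have h2 : ∀ᶠ t in 𝓝 z.1, DifferentiableAt ℝ g t :=
    ((hc.contDiffAt_implicitFunction one_ne_zero hinv).eventually (by simp)).mono
      fun t ht => ht.differentiableAt one_ne_zero
  obtain ⟨W, hW, hzW, hWo, hWs⟩ := exists_semialgebraic_nhds
    (h1.and (continuousAt_fst.eventually h2))
  refine ⟨W, g, hWo.mem_nhds hzW, hWs, fun w hw => ⟨fun h => ?_, (hW hw).2⟩⟩
  exact ((hW hw).1.1 (h.trans hz.symm)).symm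

/-- There is a differentiable function on a nonempty open subset of `V` whose graph is
semialgebraic and contained in `K`. -/
def HasSemialgebraicSection (K : Set (E × ℝ)) (V : Set E) : Prop :=
  ∃ V' ⊆ V, IsOpen V' ∧ V'.Nonempty ∧ ∃ σ : E → ℝ, DifferentiableOn ℝ σ V' ∧
    IsSemialgebraic {z : E × ℝ | z.1 ∈ V' ∧ z.2 = σ z.1} ∧ ∀ t ∈ V', (t, σ t) ∈ K

/-- By the Lindelöf property, countably many implicit-function neighbourhoods cover the simple zeros
of `P`. Projecting the corresponding pieces of `K` and applying Baire's theorem, one piece lies over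
a nonempty open set. There it is the graph of an implicit function, and this graph is semialgebraic
because the piece is. -/
theorem hasSemialgebraicSection_of_simple_root {K : Set (E × ℝ)} (hK : IsSemialgebraic K)
    {V : Set E} (hV : IsOpen V) (hne : V.Nonempty) (P : Polynomial (realPolyFunctions E))
    (h : ∀ t ∈ V, ∃ r, (t, r) ∈ K ∧ polyFun P (t, r) = 0 ∧ polyFun P.derivative (t, r) ≠ 0) :
    HasSemialgebraicSection K V := by
  set M := {z : E × ℝ | polyFun P z = 0 ∧ polyFun P.derivative z ≠ 0} with hM
  choose! W g hWn hWs hWg using fun (z : E × ℝ) (hz : z ∈ M) =>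
    exists_implicit_nhds P hz.1 hz.2
  obtain ⟨c, hcM, hc, hcov⟩ := TopologicalSpace.countable_cover_nhdsWithin (s := M) (f := W)
    fun z hz => nhdsWithin_le_nhds (hWn z hz)
  have : Countable c := hc
  have hMs : IsSemialgebraic M :=
    (isSemialgebraic_eq_zero (isPolyMap_real.2 (polyFun_mem P))).and
      (isSemialgebraic_eq_zero (isPolyMap_real.2 (polyFun_mem P.derivative))).not
  have hKs : ∀ z ∈ M, IsSemialgebraic (K ∩ M ∩ W z) := fun z hz => (hK.inter hMs).inter (hWs z hz)
  obtain ⟨z, hz⟩ := exists_interior_of_countable_cover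
    (s := fun z : c => {t | ∃ r, (t, r) ∈ K ∩ M ∩ W z})
    (fun z => (hKs z (hcM z.2)).exists) hV hne fun t ht => by
      obtain ⟨r, hr1, hr2⟩ := h t ht
      obtain ⟨z, hz, hz'⟩ := mem_iUnion₂.1 (hcov (show (t, r) ∈ M from hr2))
      exact mem_iUnion.2 ⟨⟨z, hz⟩, r, ⟨hr1, hr2⟩, hz'⟩
  obtain ⟨t₀, ht₀⟩ := hz
  obtain ⟨V', hV', ht₀', hV'o, hV's⟩ :=
    exists_semialgebraic_nhds ((isOpen_interior.inter hV).mem_nhds ht₀)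
  have key : ∀ t ∈ V', ∃ r, (t, r) ∈ K ∩ M ∩ W z := fun t ht =>
    (interior_subset (hV' ht).1 : t ∈ {t | ∃ r, (t, r) ∈ K ∩ M ∩ W z})
  have huniq : ∀ t r, (t, r) ∈ K ∩ M ∩ W z → r = g z t := fun t r hr =>
    (hWg z (hcM z.2) (t, r) hr.2).1 hr.1.2.1
  refine ⟨V', fun t ht => (hV' ht).2, hV'o, ⟨t₀, ht₀'⟩, g z, fun t ht => ?_, ?_, fun t ht => ?_⟩
  · obtain ⟨r, hr⟩ := key t ht
    exact (hWg z (hcM z.2) (t, r) hr.2).2.differentiableWithinAt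
  · convert (hV's.preimage (φ := Prod.fst) (isPolyMap_id (E := E × ℝ)).fst).inter
      (hKs z (hcM z.2)) using 1
    ext ⟨t, r⟩
    constructor
    · rintro ⟨ht, hr⟩
      obtain ⟨r', hr'⟩ := key t ht
      obtain rfl : r = r' := hr.trans (huniq _ _ hr').symm
      exact ⟨ht, hr'⟩
    · rintro ⟨ht, hr⟩
      exact ⟨ht, huniq _ _ hr⟩
  · obtain ⟨r, hr⟩ := key t ht
    rw [← huniq _ _ hr]
    exact hr.1.1

/-- A root of multiplicity `m` is a simple root of the derivative of order `m - 1`. -/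
theorem exists_simple_root_iterate_derivative {p : Polynomial ℝ} (hp : p ≠ 0) {x : ℝ}
    (hx : p.eval x = 0) : ∃ j, (Polynomial.derivative^[j] p).eval x = 0 ∧
      (Polynomial.derivative^[j + 1] p).eval x ≠ 0 := by
  have hm : 0 < p.rootMultiplicity x := (Polynomial.rootMultiplicity_pos hp).2 hx
  refine ⟨p.rootMultiplicity x - 1,
    Polynomial.isRoot_iterate_derivative_of_lt_rootMultiplicity (by lia), ?_⟩
  rw [Nat.sub_add_cancel hm, Polynomial.eval_iterate_derivative_rootMultiplicity]
  have := Polynomial.eval_divByMonic_pow_rootMultiplicity_ne_zero x hp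
  simp [Nat.factorial_ne_zero, this]

/-- A point `r` of the fibre over `t` is either a root of a defining polynomial not identically zero
on the fibre, hence a simple root of some derivative, or it has a neighbourhood in the fibre and so
a rational point nearby. These alternatives give a countable semialgebraic cover of `V`, and Baire's
theorem selects one that holds over an open set. -/
theorem hasSemialgebraicSection {K : Set (E × ℝ)} (hK : IsSemialgebraic K)
    {V : Set E} (hV : IsOpen V) (hne : V.Nonempty) (h : ∀ t ∈ V, ∃ r, (t, r) ∈ K) :
    HasSemialgebraicSection K V := by
  obtain ⟨C, hC, hCp, hCK⟩ := hK.exists_determinedBySigns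
  have : Countable C := hC.countable
  choose P hP using fun p : C => exists_polynomial_of_mem (hCp p.2)
  let M : C × ℕ → Set (E × ℝ) := fun i =>
    {z | polyFun (Polynomial.derivative^[i.2] (P i.1)) z = 0 ∧
      polyFun (Polynomial.derivative (Polynomial.derivative^[i.2] (P i.1))) z ≠ 0}
  have hMs : ∀ i, IsSemialgebraic (M i) := fun i =>
    (isSemialgebraic_eq_zero (isPolyMap_real.2 (polyFun_mem _))).and
      (isSemialgebraic_eq_zero (isPolyMap_real.2 (polyFun_mem _))).not
  let s : ℚ ⊕ (C × ℕ) → Set E :=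
    Sum.elim (fun c => {t | (t, (c : ℝ)) ∈ K}) fun i => {t | ∃ r, (t, r) ∈ K ∩ M i}
  have hs : ∀ i, IsSemialgebraic (s i) := by
    rintro (c | i)
    · exact hK.preimage (isPolyMap_id.prodMk (isPolyMap_const (c : ℝ)))
    · exact (hK.inter (hMs i)).exists
  have hcov : V ⊆ ⋃ i, s i := by
    intro t ht
    obtain ⟨r, hr⟩ := h t ht
    by_cases hex : ∃ p : C, (P p).map (polyEval t) ≠ 0 ∧ p.1 (t, r) = 0
    · obtain ⟨p, hp0, hpr⟩ := hex
      rw [hP] at hpr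
      obtain ⟨j, hj, hj'⟩ := exists_simple_root_iterate_derivative hp0 hpr
      refine mem_iUnion.2 ⟨Sum.inr (p, j), r, hr, ?_, ?_⟩
      · rwa [polyFun_iterate_derivative]
      · rwa [← Function.iterate_succ_apply' Polynomial.derivative, polyFun_iterate_derivative]
    · push Not at hex
      have hev : ∀ᶠ r' in 𝓝 r, ∀ p ∈ C, SignType.sign (p (t, r)) = SignType.sign (p (t, r')) := by
        refine (eventually_all_finite hC).2 fun p hp => ?_
        by_cases hp0 : (P ⟨p, hp⟩).map (polyEval t) = 0
        · have : ∀ r, p (t, r) = 0 := fun r => by simpa [hp0] using hP ⟨p, hp⟩ t r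
          simp [this]
        have hne := hex ⟨p, hp⟩ hp0
        have hcont : Continuous fun r' => p (t, r') :=
          (continuous_of_mem_realPolyFunctions (hCp hp)).comp (by fun_prop)
        rcases hne.lt_or_gt with hlt | hgt
        · filter_upwards [hcont.continuousAt.eventually_lt continuousAt_const hlt] with y hy
          rw [sign_neg hlt, sign_neg hy]
        · filter_upwards [continuousAt_const.eventually_lt hcont.continuousAt hgt] with y hy
          rw [sign_pos hgt, sign_pos hy]
      obtain ⟨U, hU, hUo, hrU⟩ := mem_nhds_iff.1 hev
      obtain ⟨c, hc⟩ := Rat.denseRange_cast.exists_mem_open hUo ⟨r, hrU⟩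
      exact mem_iUnion.2 ⟨Sum.inl c, hCK _ _ (hU hc) hr⟩
  obtain ⟨i, t₀, ht₀, ht₀V⟩ := exists_interior_of_countable_cover hs hV hne hcov
  have ho : IsOpen (interior (s i) ∩ V) := isOpen_interior.inter hV
  rcases i with c | i
  · obtain ⟨V', hV', ht₀', hV'o, hV's⟩ := exists_semialgebraic_nhds (ho.mem_nhds ⟨ht₀, ht₀V⟩)
    refine ⟨V', fun t ht => (hV' ht).2, hV'o, ⟨t₀, ht₀'⟩, fun _ => c,
      differentiableOn_const _, ?_, fun t ht =>
      (interior_subset (hV' ht).1 : t ∈ s (Sum.inl c))⟩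
    have h0 := isSemialgebraic_eq_zero
      ((isPolyMap_id (E := E × ℝ)).snd.sub (isPolyMap_const (c : ℝ)))
    simp only [sub_eq_zero] at h0
    exact (hV's.preimage (φ := Prod.fst) (isPolyMap_id (E := E × ℝ)).fst).inter h0
  · obtain ⟨V', hV', h1, h2, h3⟩ := hasSemialgebraicSection_of_simple_root hK ho
      ⟨t₀, ht₀, ht₀V⟩ (Polynomial.derivative^[i.2] (P i.1)) fun t ht => by
        obtain ⟨r, hr, hr1, hr2⟩ := interior_subset ht.1
        exact ⟨r, hr, hr1, hr2⟩
    exact ⟨V', hV'.trans inter_subset_right, h1, h2, h3⟩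

theorem exists_differentiable_section_pi {k : ℕ} {K : Set (E × (Fin k → ℝ))}
    (hK : IsSemialgebraic K) {V : Set E} (hV : IsOpen V) (hne : V.Nonempty)
    (h : ∀ t ∈ V, ∃ r, (t, r) ∈ K) :
    ∃ V' ⊆ V, IsOpen V' ∧ V'.Nonempty ∧ ∃ σ : E → Fin k → ℝ, DifferentiableOn ℝ σ V' ∧
      ∀ t ∈ V', (t, σ t) ∈ K := by
  induction k generalizing V with
  | zero =>
    refine ⟨V, Subset.rfl, hV, hne, fun _ => 0, differentiableOn_const _, fun t ht => ?_⟩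
    obtain ⟨r, hr⟩ := h t ht
    rwa [Subsingleton.elim r 0] at hr
  | succ k ih =>
    have hcons : IsPolyMap fun z : (E × ℝ) × (Fin k → ℝ) =>
        (z.1.1, (Fin.cons z.1.2 z.2 : Fin (k + 1) → ℝ)) :=
      isPolyMap_id.fst.fst.prodMk (isPolyMap_pi fun i => by
        refine Fin.cases ?_ (fun i => ?_) i
        · simpa using isPolyMap_id.fst.snd
        · simpa using (LinearMap.proj (R := ℝ) (φ := fun _ : Fin k => ℝ) i).isPolyMap.comp
            isPolyMap_id.snd)
    have h1 := hK.preimage hcons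
    obtain ⟨V₁, hV₁, hV₁o, hV₁n, c, hc, hcs, hcK⟩ := hasSemialgebraicSection h1.exists hV hne
      fun t ht => by
        obtain ⟨r, hr⟩ := h t ht
        exact ⟨r 0, Fin.tail r, by simpa using hr⟩
    have hswap : IsPolyMap fun z : (E × (Fin k → ℝ)) × ℝ => ((z.1.1, z.2), z.1.2) :=
      (isPolyMap_id.fst.fst.prodMk isPolyMap_id.snd).prodMk isPolyMap_id.fst.snd
    have hgr : IsPolyMap fun z : (E × (Fin k → ℝ)) × ℝ => (z.1.1, z.2) :=
      isPolyMap_id.fst.fst.prodMk isPolyMap_id.snd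
    -- The remaining coordinates must be chosen compatibly with the first one, `c t`.
    -- Semialgebraicity of the graph of `c` keeps this restricted family semialgebraic, so the
    -- induction applies.
    obtain ⟨V₂, hV₂, hV₂o, hV₂n, σ, hσ, hσK⟩ := ih
      ((hcs.preimage hgr).inter (h1.preimage hswap)).exists hV₁o hV₁n fun t ht => by
        obtain ⟨y, hy⟩ := hcK t ht
        exact ⟨y, c t, ⟨ht, rfl⟩, hy⟩
    refine ⟨V₂, hV₂.trans hV₁, hV₂o, hV₂n, fun t => Fin.cons (c t) (σ t), ?_, fun t ht => ?_⟩
    · refine differentiableOn_pi.2 fun i => ?_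
      refine Fin.cases ?_ (fun i => ?_) i
      · simpa using hc.mono hV₂
      · simpa using differentiableOn_pi.1 hσ i
    · obtain ⟨r, ⟨-, hr⟩, hrK⟩ := hσK t ht
      simp only at hr
      subst hr
      exact hrK

/-- A semialgebraic family over an open set has a differentiable section over some nonempty open
subset. -/
theorem exists_differentiable_section {K : Set (E × F)} (hK : IsSemialgebraic K) {V : Set E}
    (hV : IsOpen V) (hne : V.Nonempty) (h : ∀ t ∈ V, ∃ y, (t, y) ∈ K) :
    ∃ V' ⊆ V, IsOpen V' ∧ V'.Nonempty ∧ ∃ σ : E → F, DifferentiableOn ℝ σ V' ∧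
      ∀ t ∈ V', (t, σ t) ∈ K := by
  let e := (Module.finBasis ℝ F).equivFun.toContinuousLinearEquiv
  have h1 := hK.preimage (φ := fun z : E × (Fin (Module.finrank ℝ F) → ℝ) => (z.1, e.symm z.2))
    (isPolyMap_id.fst.prodMk (e.symm.toLinearEquiv.toLinearMap.isPolyMap.comp isPolyMap_id.snd))
  obtain ⟨V', hV', ho, hn, σ, hσ, hσK⟩ := exists_differentiable_section_pi h1 hV hne
    fun t ht => by
      obtain ⟨y, hy⟩ := h t ht
      exact ⟨e y, by simpa using hy⟩
  exact ⟨V', hV', ho, hn, fun t => e.symm (σ t),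
    e.symm.differentiable.comp_differentiableOn hσ, hσK⟩

end Sections

/-! ### Submanifolds and their tangent spaces -/

section Submanifolds

variable {E : Type*} [NormedAddCommGroup E] [NormedSpace ℝ E]
  {F : Type*} [NormedAddCommGroup F] [NormedSpace ℝ F]

theorem tangentVectors_mono {M N : Set E} (h : M ⊆ N) (p : E) :
    tangentVectors M p ⊆ tangentVectors N p := by
  rintro v ⟨γ, h0, hγ, hM⟩
  exact ⟨γ, h0, hγ, hM.mono fun s hs => h hs⟩

theorem HasFDerivWithinAt.comp_curve {φ : E → F} {φ' : E →L[ℝ] F} {s : Set E} {γ : ℝ → E} {v : E}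
    (hφ : HasFDerivWithinAt φ φ' s (γ 0)) (hγ : HasDerivAt γ v 0)
    (hs : ∀ᶠ r in 𝓝 (0 : ℝ), γ r ∈ s) : HasDerivAt (fun r => φ (γ r)) (φ' v) 0 := by
  have h : HasDerivWithinAt (φ ∘ γ) (φ' v) {r | γ r ∈ s} 0 :=
    hφ.comp_hasDerivWithinAt 0 hγ.hasDerivWithinAt fun r hr => hr
  exact h.hasDerivAt hs

theorem mem_tangentVectors_of_comp {φ : E → F} {φ' : E →L[ℝ] F} {s M : Set E} {N : Set F} {p v : E}
    (hφ : HasFDerivWithinAt φ φ' s p) (hM : M ⊆ s) (hMN : ∀ q ∈ M, φ q ∈ N)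
    (hv : v ∈ tangentVectors M p) : φ' v ∈ tangentVectors N (φ p) := by
  obtain ⟨γ, rfl, hγ, hγM⟩ := hv
  exact ⟨fun r => φ (γ r), rfl, hφ.comp_curve hγ (hγM.mono fun r hr => hM hr),
    hγM.mono fun r hr => hMN _ hr⟩

/-- Derivatives within a submanifold are not unique in the normal directions. On velocities of
curves in `M` they are determined by the values on `M`. -/
theorem fderivWithin_eq_on_tangentVectors {φ ψ : E → F} {φ' ψ' : E →L[ℝ] F} {s M : Set E} {p v : E}
    (hφ : HasFDerivWithinAt φ φ' s p) (hψ : HasFDerivWithinAt ψ ψ' s p) (hM : M ⊆ s)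
    (h : ∀ᶠ q in 𝓝 p, q ∈ M → φ q = ψ q) (hv : v ∈ tangentVectors M p) : φ' v = ψ' v := by
  obtain ⟨γ, rfl, hγ, hγM⟩ := hv
  have h1 := hφ.comp_curve hγ (hγM.mono fun r hr => hM hr)
  have h2 := hψ.comp_curve hγ (hγM.mono fun r hr => hM hr)
  refine h1.unique (h2.congr_of_eventuallyEq ?_)
  filter_upwards [hγM, hγ.continuousAt.eventually h] with r hr hr'
  exact hr' hr

/-- `f` is a local equation of `M` at `p`. -/
structure IsLocalEquation {k : ℕ} (M : Set E) (p : E) (f : E → Fin k → ℝ) : Prop where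
  contDiffAt : ContDiffAt ℝ 1 f p
  surjective : Function.Surjective (fderiv ℝ f p)
  eventually_iff : ∀ᶠ q in 𝓝 p, (q ∈ M ↔ f q = 0)

namespace IsLocalEquation

variable {k : ℕ} {M : Set E} {p : E} {f : E → Fin k → ℝ}

theorem hasFDerivAt (h : IsLocalEquation M p f) : HasFDerivAt f (fderiv ℝ f p) p :=
  (h.contDiffAt.differentiableAt one_ne_zero).hasFDerivAt

theorem apply_eq_zero (h : IsLocalEquation M p f) (hp : p ∈ M) : f p = 0 :=
  h.eventually_iff.self_of_nhds.1 hp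

theorem fderiv_eq_zero_of_mem (h : IsLocalEquation M p f) {v : E}
    (hv : v ∈ tangentVectors M p) : fderiv ℝ f p v = 0 := by
  have := fderivWithin_eq_on_tangentVectors (s := univ) (ψ := fun _ => 0)
    h.hasFDerivAt.hasFDerivWithinAt (hasFDerivWithinAt_const (0 : Fin k → ℝ) p univ)
    (subset_univ M) (h.eventually_iff.mono fun q hq => hq.1) hv
  simpa using this

theorem exists_rightInverse (h : IsLocalEquation M p f) :
    ∃ R : (Fin k → ℝ) →L[ℝ] E, ∀ w, fderiv ℝ f p (R w) = w := by
  obtain ⟨R, hR⟩ := (fderiv ℝ f p).toLinearMap.exists_rightInverse_of_surjective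
    (LinearMap.range_eq_top.2 h.surjective)
  exact ⟨R.toContinuousLinearMap, fun w => LinearMap.congr_fun hR w⟩

/-- With `R` a right inverse of `f' = fderiv ℝ f p`, the map `q - R (f' (q - p)) + R (f q)` has
identity derivative at `p` and turns `f` into the affine map `f' (· - p)`. Thus `M` becomes `p + ker
f'` near `p`. -/
theorem exists_straightening [CompleteSpace E] (h : IsLocalEquation M p f) (hp : p ∈ M) :
    ∃ θ : OpenPartialHomeomorph E E, p ∈ θ.source ∧ θ p = p ∧ ContDiffAt ℝ 1 θ p ∧
      ContDiffAt ℝ 1 θ.symm p ∧ HasFDerivAt θ.symm (ContinuousLinearMap.id ℝ E) p ∧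
      ∀ q, fderiv ℝ f p (θ q - p) = f q := by
  obtain ⟨R, hR⟩ := h.exists_rightInverse
  set f' := fderiv ℝ f p
  set g : E → E := fun q => q - R (f' (q - p)) + R (f q) with hg
  have hgp : g p = p := by simp [hg, h.apply_eq_zero hp]
  have hgc : ContDiffAt ℝ 1 g p := by
    have h1 : ContDiffAt ℝ 1 (fun q => R (f' (q - p))) p :=
      (R.contDiff.comp (f'.contDiff.comp (contDiff_id.sub contDiff_const))).contDiffAt
    exact (contDiffAt_id.sub h1).add (R.contDiff.contDiffAt.comp p h.contDiffAt)
  have hgd : HasFDerivAt g ((ContinuousLinearEquiv.refl ℝ E : E ≃L[ℝ] E) : E →L[ℝ] E) p := by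
    have h1 : HasFDerivAt (fun q => R (f' (q - p))) (R ∘L f') p :=
      (R ∘L f').hasFDerivAt.comp p ((hasFDerivAt_id p).sub_const p)
    have h2 : HasFDerivAt (fun q => R (f q)) (R ∘L f') p := R.hasFDerivAt.comp p h.hasFDerivAt
    have := ((hasFDerivAt_id p).sub h1).add h2
    rw [sub_add_cancel] at this
    exact this
  let θ := hgc.toOpenPartialHomeomorph g hgd one_ne_zero
  have hθ : (θ : E → E) = g := hgc.toOpenPartialHomeomorph_coe hgd one_ne_zero
  have hsource : p ∈ θ.source := hgc.mem_toOpenPartialHomeomorph_source hgd one_ne_zero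
  have hθp : θ p = p := by rw [hθ, hgp]
  have htarget : p ∈ θ.target := by
    have := θ.map_source hsource
    rwa [hθp] at this
  have hsymm : θ.symm p = p := by
    have := θ.left_inv hsource
    rwa [hθp] at this
  refine ⟨θ, hsource, hθp, by rwa [hθ], ?_, ?_, fun q => ?_⟩
  · exact θ.contDiffAt_symm (f₀' := ContinuousLinearEquiv.refl ℝ E) htarget
      (by rw [hsymm, hθ]; exact hgd) (by rw [hsymm, hθ]; exact hgc)
  · exact θ.hasFDerivAt_symm (f' := ContinuousLinearEquiv.refl ℝ E) htarget
      (by rw [hsymm, hθ]; exact hgd)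
  · rw [hθ]
    simp only [hg, map_sub, map_add, hR]
    abel

/-- The line `p + s • v` lies in the straightened manifold, and its pullback under the chart is a
curve in `M` with velocity `v`. -/
theorem mem_tangentVectors [CompleteSpace E] (h : IsLocalEquation M p f) (hp : p ∈ M) {v : E}
    (hv : fderiv ℝ f p v = 0) : v ∈ tangentVectors M p := by
  obtain ⟨θ, hs, hθp, -, -, hd, hf⟩ := h.exists_straightening hp
  have htarget : p ∈ θ.target := by
    have := θ.map_source hs
    rwa [hθp] at this
  have hsymm : θ.symm p = p := by
    have := θ.left_inv hs
    rwa [hθp] at this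
  have hline : HasDerivAt (fun s : ℝ => p + s • v) v 0 := by
    simpa using ((hasDerivAt_id (0 : ℝ)).smul_const v).const_add p
  have h0 : p + (0 : ℝ) • v = p := by simp
  have hγ : HasDerivAt (fun s : ℝ => θ.symm (p + s • v)) v 0 := by
    have h1 : HasFDerivWithinAt θ.symm (ContinuousLinearMap.id ℝ E) univ (p + (0 : ℝ) • v) := by
      rw [h0]; exact hd.hasFDerivWithinAt
    exact h1.comp_curve (γ := fun s : ℝ => p + s • v) hline (by simp)
  refine ⟨_, by simp [hsymm], hγ, ?_⟩
  have hev : ∀ᶠ s in 𝓝 (0 : ℝ), p + s • v ∈ θ.target :=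
    hline.continuousAt.eventually (by simp only [h0]; exact θ.open_target.mem_nhds htarget)
  have hev2 := hγ.continuousAt.eventually (p := fun q => q ∈ M ↔ f q = 0)
    (by simp only [h0, hsymm]; exact h.eventually_iff)
  filter_upwards [hev, hev2] with s hs1 hs2
  rw [hs2, ← hf, θ.right_inv hs1]
  simp [hv]

theorem tangentVectors_eq [CompleteSpace E] (h : IsLocalEquation M p f) (hp : p ∈ M) :
    tangentVectors M p = {v | fderiv ℝ f p v = 0} :=
  Subset.antisymm (fun _ hv => h.fderiv_eq_zero_of_mem hv)
    fun _ hv => h.mem_tangentVectors hp hv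

/-- In the straightening chart the retraction is the affine projection along the range of `R`. -/
theorem exists_retraction [CompleteSpace E] (h : IsLocalEquation M p f) (hp : p ∈ M) :
    ∃ r : E → E, ContDiffAt ℝ 1 r p ∧ (∀ᶠ q in 𝓝 p, r q ∈ M) ∧ ∀ᶠ q in 𝓝 p, q ∈ M → r q = q := by
  obtain ⟨θ, hs, hθp, hc, hcs, -, hf⟩ := h.exists_straightening hp
  obtain ⟨R, hR⟩ := h.exists_rightInverse
  have htarget : p ∈ θ.target := by
    have := θ.map_source hs
    rwa [hθp] at this
  have hsymm : θ.symm p = p := by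
    have := θ.left_inv hs
    rwa [hθp] at this
  set g : E → E := fun q => θ q - R (f q) with hg
  have hgp : g p = p := by simp [hg, hθp, h.apply_eq_zero hp]
  have hgc : ContDiffAt ℝ 1 g p := hc.sub (R.contDiff.contDiffAt.comp p h.contDiffAt)
  have hrc : ContDiffAt ℝ 1 (fun q => θ.symm (g q)) p :=
    ContDiffAt.comp p (by rwa [hgp]) hgc
  refine ⟨fun q => θ.symm (g q), hrc, ?_, ?_⟩
  · have h1 := hgc.continuousAt.eventually (p := fun q => q ∈ θ.target)
      (by rw [hgp]; exact θ.open_target.mem_nhds htarget)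
    have h2 := hrc.continuousAt.eventually (p := fun q => q ∈ M ↔ f q = 0)
      (by simp only [hgp, hsymm]; exact h.eventually_iff)
    filter_upwards [h1, h2] with q hq1 hq2
    rw [hq2, ← hf, θ.right_inv hq1]
    have : g q - p = (θ q - p) - R (f q) := by rw [hg]; simp only; abel
    rw [this, map_sub, hf, hR, sub_self]
  · filter_upwards [h.eventually_iff, θ.open_source.mem_nhds hs] with q hq hqs hqM
    simp only [hg, hq.1 hqM, map_zero, sub_zero]
    exact θ.left_inv hqs

end IsLocalEquation

theorem IsC1Submanifold.exists_localEquation {M : Set E} (h : IsC1Submanifold M) :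
    ∃ k : ℕ, ∀ p ∈ M, ∃ f : E → Fin k → ℝ, IsLocalEquation M p f := by
  obtain ⟨d, k, -, h⟩ := h
  refine ⟨k, fun p hp => ?_⟩
  obtain ⟨f, h1, h2, h3⟩ := h p hp
  exact ⟨f, h1, h2, h3⟩

theorem IsC1Submanifold.add_mem_tangentVectors [CompleteSpace E] {M : Set E}
    (h : IsC1Submanifold M) {p u v : E} (hp : p ∈ M) (hu : u ∈ tangentVectors M p)
    (hv : v ∈ tangentVectors M p) : u + v ∈ tangentVectors M p := by
  obtain ⟨k, hk⟩ := h.exists_localEquation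
  obtain ⟨f, hf⟩ := hk p hp
  rw [hf.tangentVectors_eq hp] at *
  simp_all

/-! ### Images of submanifolds under diffeomorphisms -/

/-- `φ` restricts to a `C¹` diffeomorphism of `S` with inverse `ψ`. -/
structure IsDiffeoOn (S : Set E) (φ ψ : E → E) : Prop where
  contDiffOn : ContDiffOn ℝ 1 φ S
  contDiffOn_inv : ContDiffOn ℝ 1 ψ S
  bijOn : BijOn φ S S
  leftInv : ∀ x ∈ S, ψ (φ x) = x

theorem IsDiffeoOn.mapsTo_inv {S : Set E} {φ ψ : E → E} (h : IsDiffeoOn S φ ψ) :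
    MapsTo ψ S S := by
  intro y hy
  obtain ⟨x, hx, rfl⟩ := h.bijOn.surjOn hy
  rwa [h.leftInv x hx]

/-- A diffeomorphism of a submanifold extends locally to a diffeomorphism of the ambient space. -/
theorem IsDiffeoOn.exists_extension [FiniteDimensional ℝ E] {S : Set E} (hS : IsC1Submanifold S)
    {φ ψ : E → E} (h : IsDiffeoOn S φ ψ) {p : E} (hp : p ∈ S) :
    ∃ Φ : E → E, ContDiffAt ℝ 1 Φ p ∧ (∀ᶠ q in 𝓝 p, q ∈ S → Φ q = φ q) ∧
      ∃ A : E ≃L[ℝ] E, HasFDerivAt Φ (A : E →L[ℝ] E) p := by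
  have : CompleteSpace E := FiniteDimensional.complete ℝ E
  obtain ⟨k, hk⟩ := hS.exists_localEquation
  have hp' := h.bijOn.mapsTo hp
  obtain ⟨f, hf⟩ := hk p hp
  obtain ⟨g, hg⟩ := hk (φ p) hp'
  obtain ⟨r, hrc, hrS, hrid⟩ := hf.exists_retraction hp
  obtain ⟨L, hL⟩ := hg.exists_rightInverse
  have hrp : r p = p := hrid.self_of_nhds hp
  have hφr : ContDiffAt ℝ 1 (fun q => φ (r q)) p := by
    have h1 : ContDiffWithinAt ℝ 1 φ S (r p) := by rw [hrp]; exact h.contDiffOn p hp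
    have h2 := h1.comp (s := r ⁻¹' S) p hrc.contDiffWithinAt fun q hq => hq
    exact h2.contDiffAt hrS
  -- The first summand transports the tangent directions, and the second matches the normal
  -- directions at `p` with those at `φ p`. The equations `f` and `g` have the same number `k` of
  -- components.
  set Φ : E → E := fun q => φ (r q) + L (f q) with hΦ
  have hΦc : ContDiffAt ℝ 1 Φ p := hφr.add (L.contDiff.contDiffAt.comp p hf.contDiffAt)
  set B := fderiv ℝ (fun q => φ (r q)) p
  have hB : HasFDerivAt (fun q => φ (r q)) B p :=
    (hφr.differentiableAt one_ne_zero).hasFDerivAt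
  have hΦd : HasFDerivAt Φ (B + L ∘L fderiv ℝ f p) p :=
    hB.add (L.hasFDerivAt.comp p hf.hasFDerivAt)
  have hφrS : ∀ᶠ q in 𝓝 p, φ (r q) ∈ S := hrS.mono fun q hq => h.bijOn.mapsTo hq
  have hgB : ∀ v, fderiv ℝ g (φ p) (B v) = 0 := by
    have h1 : HasFDerivAt (fun q => g (φ (r q))) (fderiv ℝ g (φ p) ∘L B) p := by
      refine HasFDerivAt.comp p ?_ hB
      rw [hrp]
      exact hg.hasFDerivAt
    have h2 : (fun q => g (φ (r q))) =ᶠ[𝓝 p] fun _ => 0 := by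
      have := hφr.continuousAt.eventually (p := fun q => q ∈ S ↔ g q = 0)
        (by simp only [hrp]; exact hg.eventually_iff)
      filter_upwards [this, hφrS] with q hq hq'
      exact hq.1 hq'
    have h3 := h1.unique ((hasFDerivAt_const (0 : Fin k → ℝ) p).congr_of_eventuallyEq h2)
    intro v
    have := DFunLike.congr_fun h3 v
    simpa using this
  -- Applying `fderiv ℝ g (φ p)` kills the tangential part and leaves `fderiv ℝ f p v = 0`, so `v`
  -- is tangent to `S`. There the derivative of `φ` is inverted by that of `ψ`.
  have hinj : Function.Injective (B + L ∘L fderiv ℝ f p) := by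
    rw [injective_iff_map_eq_zero]
    intro v hv
    have hv' : B v + L (fderiv ℝ f p v) = 0 := hv
    have hfv : fderiv ℝ f p v = 0 := by
      have := congrArg (fderiv ℝ g (φ p)) hv'
      simpa [hgB, hL] using this
    have hBv : B v = 0 := by simpa [hfv] using hv'
    have hvS := hf.mem_tangentVectors hp hfv
    have hψ : HasFDerivWithinAt ψ (fderivWithin ℝ ψ S (φ p)) S (φ p) :=
      ((h.contDiffOn_inv _ hp').differentiableWithinAt one_ne_zero).hasFDerivWithinAt
    have hφ : HasFDerivWithinAt φ (fderivWithin ℝ φ S p) S p :=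
      ((h.contDiffOn _ hp).differentiableWithinAt one_ne_zero).hasFDerivWithinAt
    have h1 : B v = fderivWithin ℝ φ S p v :=
      fderivWithin_eq_on_tangentVectors (M := S) hB.hasFDerivWithinAt hφ Subset.rfl
        (hrid.mono fun q hq hqS => by rw [hq hqS]) hvS
    have h2 : fderivWithin ℝ ψ S (φ p) (fderivWithin ℝ φ S p v) = v :=
      fderivWithin_eq_on_tangentVectors (M := S) (φ := fun q => ψ (φ q)) (ψ := fun q => q)
        (hψ.comp p hφ h.bijOn.mapsTo) (hasFDerivWithinAt_id p S) Subset.rfl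
        (Eventually.of_forall fun q hq => h.leftInv q hq) hvS
    rw [← h2, ← h1, hBv, map_zero]
  refine ⟨Φ, hΦc, ?_, (LinearEquiv.ofInjectiveEndo _ hinj).toContinuousLinearEquiv, ?_⟩
  · filter_upwards [hrid, hf.eventually_iff] with q hq hq' hqS
    simp [hΦ, hq hqS, hq'.1 hqS]
  · convert hΦd using 1
    ext v
    rfl

theorem IsC1Submanifold.preimage_diffeo [FiniteDimensional ℝ E] {S B : Set E}
    (hS : IsC1Submanifold S) (hB : IsC1Submanifold B) (hBS : B ⊆ S) {φ ψ : E → E}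
    (h : IsDiffeoOn S φ ψ) : IsC1Submanifold {x ∈ S | φ x ∈ B} := by
  have : CompleteSpace E := FiniteDimensional.complete ℝ E
  obtain ⟨d, k, hdk, hB⟩ := hB
  refine ⟨d, k, hdk, ?_⟩
  rintro p ⟨hp, hpB⟩
  obtain ⟨Φ, hΦc, hΦφ, A, hA⟩ := h.exists_extension hS hp
  have hΦp : Φ p = φ p := hΦφ.self_of_nhds hp
  obtain ⟨g, hgc, hgs, hg⟩ := hB (φ p) hpB
  rw [← hΦp] at hgc hgs hg
  have hgd : HasFDerivAt (fun q => g (Φ q)) (fderiv ℝ g (Φ p) ∘L (A : E →L[ℝ] E)) p :=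
    (hgc.differentiableAt one_ne_zero).hasFDerivAt.comp p hA
  refine ⟨fun q => g (Φ q), hgc.comp p hΦc, ?_, ?_⟩
  · rw [hgd.fderiv]
    exact hgs.comp A.surjective
  have hΦg := hΦc.continuousAt.eventually hg
  let θ := hΦc.toOpenPartialHomeomorph Φ hA one_ne_zero
  have hθ : (θ : E → E) = Φ := hΦc.toOpenPartialHomeomorph_coe hA one_ne_zero
  have hsource : θ.source ∈ 𝓝 p :=
    θ.open_source.mem_nhds (hΦc.mem_toOpenPartialHomeomorph_source hA one_ne_zero)
  have hψc : Tendsto ψ (𝓝[S] (Φ p)) (𝓝 p) := by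
    have := (h.contDiffOn_inv _ (h.bijOn.mapsTo hp)).continuousWithinAt.tendsto
    rwa [h.leftInv p hp, ← hΦp] at this
  -- For the converse of the local equation, `Φ q ∈ B` must imply `q ∈ S`. The point `ψ (Φ q)` lies
  -- in `S`, is near `p` by continuity and has the same image as `q`, so local injectivity of `Φ`
  -- identifies the two.
  have hev : ∀ᶠ q in 𝓝 p, Φ q ∈ S →
      (ψ (Φ q) ∈ θ.source ∧ (ψ (Φ q) ∈ S → Φ (ψ (Φ q)) = φ (ψ (Φ q)))) :=
    hΦc.continuousAt.eventually
      (eventually_nhdsWithin_iff.1 (hψc.eventually (Filter.Eventually.and hsource hΦφ)))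
  filter_upwards [hΦg, hev, hΦφ, hsource] with q h1 h2 h3 h4
  constructor
  · rintro ⟨hqS, hqB⟩
    rw [← h1, h3 hqS]
    exact hqB
  · intro hq
    have hqB : Φ q ∈ B := h1.2 hq
    obtain ⟨h5, h6⟩ := h2 (hBS hqB)
    have hw := h.mapsTo_inv (hBS hqB)
    have h7 : φ (ψ (Φ q)) = Φ q := by
      obtain ⟨x, hx, hxq⟩ := h.bijOn.surjOn (hBS hqB)
      rw [← hxq, h.leftInv x hx]
    have h8 : ψ (Φ q) = q := θ.injOn h5 h4 (by rw [hθ, h6 hw, h7])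
    rw [h8] at hw h7
    exact ⟨hw, by rwa [h7]⟩

/-! ### Transversality from a section -/

theorem exists_add_eq_of_section {P : Type*} [NormedAddCommGroup P] [NormedSpace ℝ P]
    [FiniteDimensional ℝ E] {U : Set P} {S A B : Set E} (hS : IsC1Submanifold S)
    (hAS : A ⊆ S) (hBS : B ⊆ S) {H : P × E → E} {ψ : E → E} {t₀ : P} {σ : P → E}
    (hU : U ∈ 𝓝 t₀) (hH : ContDiffOn ℝ 1 H (U ×ˢ S))
    (hdiff : IsDiffeoOn S (fun x => H (t₀, x)) ψ)
    (hσd : DifferentiableAt ℝ σ t₀) (hσA : ∀ᶠ t in 𝓝 t₀, σ t ∈ A)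
    (hσB : ∀ᶠ t in 𝓝 t₀, H (t, σ t) ∈ B)
    (hsub : tangentVectors S (H (t₀, σ t₀)) ⊆ range (fderiv ℝ (fun t => H (t, σ t₀)) t₀))
    {w : E} (hw : w ∈ tangentVectors S (σ t₀)) :
    ∃ u ∈ tangentVectors A (σ t₀),
      ∃ v ∈ tangentVectors {x ∈ S | H (t₀, x) ∈ B} (σ t₀), u + v = w := by
  have : CompleteSpace E := FiniteDimensional.complete ℝ E
  set x₀ := σ t₀ with hx₀
  have ht₀ : t₀ ∈ U := mem_of_mem_nhds hU
  have hx₀S : x₀ ∈ S := hAS hσA.self_of_nhds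
  set H' := fderivWithin ℝ H (U ×ˢ S) (t₀, x₀)
  have hH' : HasFDerivWithinAt H H' (U ×ˢ S) (t₀, x₀) :=
    ((hH _ ⟨ht₀, hx₀S⟩).differentiableWithinAt one_ne_zero).hasFDerivWithinAt
  have hHx : HasFDerivWithinAt (fun x => H (t₀, x)) (H' ∘L .inr ℝ P E) S x₀ :=
    HasFDerivWithinAt.comp (t := U ×ˢ S) x₀ hH'
      (hasFDerivAt_prodMk_right t₀ x₀).hasFDerivWithinAt fun x hx => mk_mem_prod ht₀ hx
  have hHt : fderiv ℝ (fun t => H (t, x₀)) t₀ = H' ∘L .inl ℝ P E := by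
    have : HasFDerivWithinAt (fun t => H (t, x₀)) (H' ∘L .inl ℝ P E) U t₀ :=
      HasFDerivWithinAt.comp (t := U ×ˢ S) t₀ hH'
        (hasFDerivAt_prodMk_left t₀ x₀).hasFDerivWithinAt fun t ht => mk_mem_prod ht hx₀S
    exact (this.hasFDerivAt hU).fderiv
  have hHw := mem_tangentVectors_of_comp hHx Subset.rfl hdiff.bijOn.mapsTo hw
  obtain ⟨τ, hτ⟩ := hsub hHw
  rw [hHt] at hτ
  have hline : ∀ c : ℝ, HasDerivAt (fun s : ℝ => t₀ + s • (c • τ)) (c • τ) 0 := fun c => by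
    simpa using ((hasDerivAt_id (0 : ℝ)).smul_const (c • τ)).const_add t₀
  have hlim : ∀ c : ℝ, Tendsto (fun s : ℝ => t₀ + s • (c • τ)) (𝓝 0) (𝓝 t₀) := fun c => by
    simpa using (hline c).continuousAt.tendsto
  have hσc : ∀ c : ℝ, HasDerivAt (fun s : ℝ => σ (t₀ + s • (c • τ))) (fderiv ℝ σ t₀ (c • τ)) 0 := by
    intro c
    have h1 : HasFDerivWithinAt σ (fderiv ℝ σ t₀) univ (t₀ + (0 : ℝ) • (c • τ)) := by
      simpa using hσd.hasFDerivAt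
    exact h1.comp_curve (γ := fun s : ℝ => t₀ + s • (c • τ)) (hline c) (by simp)
  -- The parameters `c = 1` and `c = -1` give `u` and `-u` as tangent vectors by running the curve
  -- both ways, with no submanifold structure on `A`.
  have hu : ∀ c : ℝ, fderiv ℝ σ t₀ (c • τ) ∈ tangentVectors A x₀ := fun c =>
    ⟨_, by simp [hx₀], hσc c, (hlim c).eventually hσA⟩
  set u := fderiv ℝ σ t₀ τ with hu_def
  have hu1 : u ∈ tangentVectors A x₀ := by simpa using hu 1
  have hun : -u ∈ tangentVectors A x₀ := by simpa using hu (-1)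
  have hwu : w + u ∈ tangentVectors S x₀ :=
    hS.add_mem_tangentVectors hx₀S hw (tangentVectors_mono hAS _ hu1)
  refine ⟨-u, hun, w + u, ?_, by abel⟩
  -- The curve `H (t₀ + s • τ, σ (t₀ + s • τ))` stays in `B`. Its velocity is `H' (τ, 0) + H' (0,
  -- u)`, and `H' (τ, 0) = H' (0, w)` by the choice of `τ`.
  have hcurve : H' (0, w + u) ∈ tangentVectors B (H (t₀, x₀)) := by
    have hpair := (hline 1).prodMk (hσc 1)
    have hmem : ∀ᶠ s in 𝓝 (0 : ℝ),
        (t₀ + s • ((1 : ℝ) • τ), σ (t₀ + s • ((1 : ℝ) • τ))) ∈ U ×ˢ S := by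
      filter_upwards [(hlim 1).eventually hU, (hlim 1).eventually hσA] with s h1 h2
      exact ⟨h1, hAS h2⟩
    have h1 : HasFDerivWithinAt H H' (U ×ˢ S)
        ((fun s : ℝ => (t₀ + s • ((1 : ℝ) • τ), σ (t₀ + s • ((1 : ℝ) • τ)))) 0) := by
      simpa [← hx₀] using hH'
    have h2 := h1.comp_curve hpair hmem
    refine ⟨_, by simp [← hx₀], ?_, (hlim 1).eventually hσB⟩
    convert h2 using 1
    have e1 : H' (τ, 0) = H' (0, w) := hτ
    have e2 : ((0 : P), w + u) = (0, w) + (0, u) := by simp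
    have e3 : ((1 : ℝ) • τ, fderiv ℝ σ t₀ ((1 : ℝ) • τ)) = (τ, 0) + (0, u) := by simp [hu_def]
    rw [e2, e3, map_add, map_add, e1]
  have hψ : HasFDerivWithinAt ψ (fderivWithin ℝ ψ S (H (t₀, x₀))) S (H (t₀, x₀)) :=
    ((hdiff.contDiffOn_inv _ (hdiff.bijOn.mapsTo hx₀S)).differentiableWithinAt
      one_ne_zero).hasFDerivWithinAt
  have hback := mem_tangentVectors_of_comp (N := {x ∈ S | H (t₀, x) ∈ B}) hψ hBS (fun y hy => by
    obtain ⟨x, hx, rfl⟩ := hdiff.bijOn.surjOn (hBS hy)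
    simp only at hy
    rw [hdiff.leftInv x hx]
    exact ⟨hx, hy⟩) hcurve
  have hid : fderivWithin ℝ ψ S (H (t₀, x₀)) (H' (0, w + u)) = w + u :=
    fderivWithin_eq_on_tangentVectors (M := S) (φ := fun q => ψ (H (t₀, q))) (ψ := fun q => q)
      (hψ.comp x₀ hHx hdiff.bijOn.mapsTo) (hasFDerivWithinAt_id x₀ S) Subset.rfl
      (Eventually.of_forall fun q hq => hdiff.leftInv q hq) hwu
  rwa [hid, hdiff.leftInv x₀ hx₀S] at hback

/-! ### Semialgebraicity of tangent spaces -/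

/-- The limits of secants of `M` at `p`. -/
def secantLimits [FiniteDimensional ℝ E] (M : Set E) (p : E) : Set E :=
  {v | ∀ ε : ℝ, 0 < ε → ∃ (q : E) (c : ℝ),
    q ∈ M ∧ sqNorm (q - p) < ε ∧ sqNorm (c • (q - p) - v) < ε}

/-- This trades a quantifier over curves for quantifiers over points and numbers, to which
Tarski–Seidenberg applies. Difference quotients give one inclusion. For the other, secants near `p`
lie in the closed cone `‖f' w‖ ≤ c ‖w‖`, with `f'` the differential of a local equation. Their
limits therefore lie in it for every `c > 0`, which forces `f' v = 0`. -/
theorem tangentVectors_eq_secantLimits [FiniteDimensional ℝ E] {M : Set E}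
    (hM : IsC1Submanifold M) {p : E} (hp : p ∈ M) : tangentVectors M p = secantLimits M p := by
  have : CompleteSpace E := FiniteDimensional.complete ℝ E
  obtain ⟨k, hk⟩ := hM.exists_localEquation
  obtain ⟨f, hf⟩ := hk p hp
  refine Subset.antisymm ?_ fun v hv => hf.mem_tangentVectors hp ?_
  · rintro v ⟨γ, rfl, hγ, hγM⟩ ε hε
    have h1 : ∀ᶠ s in 𝓝[≠] (0 : ℝ), sqNorm (γ s - γ 0) < ε := by
      refine nhdsWithin_le_nhds (ContinuousAt.eventually_lt ?_ continuousAt_const (by simpa))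
      exact continuous_sqNorm.continuousAt.comp (hγ.continuousAt.sub continuousAt_const)
    have h2 : ∀ᶠ s in 𝓝[≠] (0 : ℝ), sqNorm (s⁻¹ • (γ s - γ 0) - v) < ε := by
      have h3 : Tendsto (fun s : ℝ => s⁻¹ • (γ s - γ 0) - v) (𝓝[≠] 0) (𝓝 0) := by
        have := (hasDerivAt_iff_tendsto_slope_zero.1 hγ).sub_const v
        simpa using this
      have h4 := (continuous_sqNorm.tendsto (0 : E)).comp h3
      exact h4.eventually (by simpa using gt_mem_nhds hε)
    obtain ⟨s, ⟨hs1, hs2⟩, hs3⟩ := ((h1.and h2).and (nhdsWithin_le_nhds hγM)).exists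
    exact ⟨γ s, s⁻¹, hs3, hs1, hs2⟩
  · have key : ∀ c : ℝ, 0 < c → ‖fderiv ℝ f p v‖ ≤ c * ‖v‖ := by
      intro c hc
      have hclosed : IsClosed {w | ‖fderiv ℝ f p w‖ ≤ c * ‖w‖} :=
        isClosed_le (by fun_prop) (by fun_prop)
      have hev : ∀ᶠ q in 𝓝 p, q ∈ M → ‖fderiv ℝ f p (q - p)‖ ≤ c * ‖q - p‖ := by
        have := hf.hasFDerivAt.isLittleO.def hc
        filter_upwards [this, hf.eventually_iff] with q hq hq' hqM
        rwa [hq'.1 hqM, hf.apply_eq_zero hp, sub_self, zero_sub, norm_neg] at hq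
      have hv' : v ∈ closure {w | ‖fderiv ℝ f p w‖ ≤ c * ‖w‖} := by
        rw [mem_closure_iff_nhds]
        intro V hV
        obtain ⟨ε₁, hε₁, h1⟩ := exists_sqNorm_lt_subset hV
        obtain ⟨ε₂, hε₂, h2⟩ := exists_sqNorm_lt_subset hev
        obtain ⟨q, a, hqM, hq1, hq2⟩ := hv (min ε₁ ε₂) (lt_min hε₁ hε₂)
        refine ⟨a • (q - p), h1 _ (hq2.trans_le (min_le_left _ _)), ?_⟩
        have := h2 q (hq1.trans_le (min_le_right _ _)) hqM
        change ‖fderiv ℝ f p (a • (q - p))‖ ≤ c * ‖a • (q - p)‖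
        rw [map_smul, norm_smul, norm_smul, mul_left_comm]
        exact mul_le_mul_of_nonneg_left this (norm_nonneg a)
      rwa [hclosed.closure_eq] at hv'
    have hlim : Tendsto (fun c : ℝ => c * ‖v‖) (𝓝[>] 0) (𝓝 0) := by
      have : Continuous fun c : ℝ => c * ‖v‖ := by fun_prop
      simpa using (this.tendsto 0).mono_left nhdsWithin_le_nhds
    have := ge_of_tendsto hlim (by filter_upwards [self_mem_nhdsWithin] with c hc using key c hc)
    exact norm_le_zero_iff.1 this

theorem isSemialgebraic_secantLimits [FiniteDimensional ℝ E] {D : Set (F × E)}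
    (hD : IsSemialgebraic D) :
    IsSemialgebraic {z : F × E × E | z.2.2 ∈ secantLimits {q | (z.1, q) ∈ D} z.2.1} := by
  have h1 : IsSemialgebraic {y : (((F × E × E) × ℝ) × E) × ℝ |
      (y.1.1.1.1, y.1.2) ∈ D ∧ sqNorm (y.1.2 - y.1.1.1.2.1) < y.1.1.2 ∧
        sqNorm (y.2 • (y.1.2 - y.1.1.1.2.1) - y.1.1.1.2.2) < y.1.1.2} := by
    have i := isPolyMap_id (E := (((F × E × E) × ℝ) × E) × ℝ)
    refine (hD.preimage (i.fst.fst.fst.fst.prodMk i.fst.snd)).and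
      ((isSemialgebraic_lt (isPolyMap_sqNorm.comp (i.fst.snd.sub i.fst.fst.fst.snd.fst))
        i.fst.fst.snd).and
      (isSemialgebraic_lt (isPolyMap_sqNorm.comp
        ((i.snd.smul (i.fst.snd.sub i.fst.fst.fst.snd.fst)).sub i.fst.fst.fst.snd.snd))
        i.fst.fst.snd))
  have h2 : IsSemialgebraic {y : (F × E × E) × ℝ | 0 < y.2} :=
    isSemialgebraic_lt (isPolyMap_const 0) isPolyMap_id.snd
  exact (h2.imp h1.exists.exists).forall

end Submanifolds

/-! ### Strata in projective space -/

section Strata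

variable {𝕜 : Type*} [RCLike 𝕜] {n : ℕ}

theorem continuousOn_lineMatrix :
    ContinuousOn (lineMatrix : (Fin (n + 1) → 𝕜) → MatSpace 𝕜 n) {v | v ≠ 0} := by
  refine continuousOn_pi.2 fun i => continuousOn_pi.2 fun j => ?_
  unfold lineMatrix
  refine ContinuousOn.div (Continuous.continuousOn ?_) (Continuous.continuousOn ?_) fun v hv => ?_
  · exact (continuous_apply i).mul (RCLike.continuous_conj.comp (continuous_apply j))
  · exact RCLike.continuous_ofReal.comp
      (continuous_finsetSum _ fun k _ => ((continuous_apply k).norm.pow 2))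
  · exact_mod_cast (sum_norm_sq_pos hv).ne'

/-- Every line has a representative on the unit sphere. Compactness turns local finiteness of a
stratification into finiteness. -/
theorem exists_isCompact_range_projEmb_subset :
    ∃ K : Set (MatSpace 𝕜 n), IsCompact K ∧ range (projEmb : ProjSpace 𝕜 n → _) ⊆ K := by
  refine ⟨lineMatrix '' Metric.sphere (0 : Fin (n + 1) → 𝕜) 1,
    (isCompact_sphere _ _).image_of_continuousOn (continuousOn_lineMatrix.mono fun v hv => ?_), ?_⟩
  · exact ne_zero_of_mem_unit_sphere ⟨v, hv⟩
  · rintro _ ⟨x, rfl⟩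
    induction x using Projectivization.ind with
    | h v hv =>
    have hv' : ‖v‖ ≠ 0 := norm_ne_zero_iff.2 hv
    refine ⟨((‖v‖⁻¹ : ℝ) : 𝕜) • v, ?_, ?_⟩
    · rw [mem_sphere_zero_iff_norm, norm_smul, RCLike.norm_ofReal, abs_inv, abs_norm,
        inv_mul_cancel₀ hv']
    · rw [projEmb_mk, lineMatrix_smul _ (by simpa using hv')]

theorem IsStratification.finite {𝒮 : Set (Set (ProjSpace 𝕜 n))} {X : Set (ProjSpace 𝕜 n)}
    (h : IsStratification 𝒮 X) : 𝒮.Finite := by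
  obtain ⟨K, hK, hrange⟩ := exists_isCompact_range_projEmb_subset (𝕜 := 𝕜) (n := n)
  have h1 := h.locallyFinite.finite_nonempty_inter_compact hK
  have h2 : {S : 𝒮 | ((projEmb '' (S : Set (ProjSpace 𝕜 n))) ∩ K).Nonempty} = univ := by
    refine eq_univ_of_forall fun S => ?_
    obtain ⟨x, hx⟩ := h.nonempty S S.2
    exact ⟨projEmb x, mem_image_of_mem _ hx, hrange (mem_range_self x)⟩
  rw [h2] at h1
  exact finite_coe_iff.1 (finite_univ_iff.1 h1)

theorem IsStratification.exists_mem {𝒮 : Set (Set (ProjSpace 𝕜 n))}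
    (h : IsStratification 𝒮 univ) (x : ProjSpace 𝕜 n) : ∃ S ∈ 𝒮, x ∈ S := by
  have : x ∈ ⋃₀ 𝒮 := by rw [h.sUnion_eq]; trivial
  exact this

/-! ### Pulling strata back along the family. -/

variable {m : ℕ} {U : Set (Fin m → 𝕜)} {𝒮 : Set (Set (ProjSpace 𝕜 n))}
  {Ψ : (Fin m → 𝕜) → ProjSpace 𝕜 n → ProjSpace 𝕜 n} {S B : Set (ProjSpace 𝕜 n)}
  {t : Fin m → 𝕜}

/-- The strata partition the whole space and each is mapped into itself, so a point cannot enter `S`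
from another stratum. -/
theorem IsStratifiedSubmersiveFamily.mem_of_apply_mem (h𝒮 : IsStratification 𝒮 univ)
    (hΨ : IsStratifiedSubmersiveFamily U 𝒮 Ψ) (ht : t ∈ U) (hS : S ∈ 𝒮) {x : ProjSpace 𝕜 n}
    (hx : Ψ t x ∈ S) : x ∈ S := by
  obtain ⟨S', hS', hxS'⟩ := h𝒮.exists_mem x
  have h1 := ((hΨ S' hS').bijOn t ht).mapsTo hxS'
  rwa [h𝒮.disjoint.elim_set hS hS' _ hx h1]

theorem IsSubmersiveFamily.exists_diffeo (h : IsSubmersiveFamily U S Ψ) :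
    ∃ H : (Fin m → 𝕜) × MatSpace 𝕜 n → MatSpace 𝕜 n,
      ContDiffOn ℝ 1 H (U ×ˢ (projEmb '' S)) ∧
      (∀ t ∈ U, ∀ x ∈ S, H (t, projEmb x) = projEmb (Ψ t x)) ∧
      ∀ t ∈ U, ∃ G, IsDiffeoOn (projEmb '' S) (fun x => H (t, x)) G := by
  obtain ⟨H, hH, hHΨ⟩ := h.smooth
  refine ⟨H, hH, hHΨ, fun t ht => ?_⟩
  obtain ⟨G, hG, hGΨ⟩ := h.smooth_inv t ht
  have hb := h.bijOn t ht
  refine ⟨G, hH.comp (contDiff_prodMk_right t).contDiffOn fun x hx => mk_mem_prod ht hx, hG,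
    ⟨?_, ?_, ?_⟩, ?_⟩
  · rintro _ ⟨x, hx, rfl⟩
    exact ⟨Ψ t x, hb.mapsTo hx, (hHΨ t ht x hx).symm⟩
  · rintro _ ⟨x, hx, rfl⟩ _ ⟨y, hy, rfl⟩ hxy
    simp only [hHΨ t ht x hx, hHΨ t ht y hy] at hxy
    rw [hb.injOn hx hy (projEmb_injective hxy)]
  · rintro _ ⟨y, hy, rfl⟩
    obtain ⟨x, hx, rfl⟩ := hb.surjOn hy
    exact ⟨projEmb x, mem_image_of_mem _ hx, hHΨ t ht x hx⟩
  · rintro _ ⟨x, hx, rfl⟩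
    simp only [hHΨ t ht x hx]
    exact hGΨ x hx

theorem IsStratifiedSubmersiveFamily.image_preimage (h𝒮 : IsStratification 𝒮 univ)
    (hΨ : IsStratifiedSubmersiveFamily U 𝒮 Ψ) (ht : t ∈ U) (hS : S ∈ 𝒮) (hBS : B ⊆ S)
    {H : (Fin m → 𝕜) × MatSpace 𝕜 n → MatSpace 𝕜 n}
    (hH : ∀ t ∈ U, ∀ x ∈ S, H (t, projEmb x) = projEmb (Ψ t x)) :
    projEmb '' (Ψ t ⁻¹' B) = {x ∈ projEmb '' S | H (t, x) ∈ projEmb '' B} := by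
  ext z
  constructor
  · rintro ⟨x, hx, rfl⟩
    have hxS := hΨ.mem_of_apply_mem h𝒮 ht hS (hBS hx)
    refine ⟨mem_image_of_mem _ hxS, ?_⟩
    rw [hH t ht x hxS]
    exact mem_image_of_mem _ hx
  · rintro ⟨⟨x, hx, rfl⟩, hB⟩
    rw [hH t ht x hx, projEmb_injective.mem_set_image] at hB
    exact mem_image_of_mem _ hB

theorem IsStratifiedSubmersiveFamily.isC1Submanifold_preimage (h𝒮 : IsStratification 𝒮 univ)
    (hΨ : IsStratifiedSubmersiveFamily U 𝒮 Ψ) (ht : t ∈ U) (hS : S ∈ 𝒮) (hBS : B ⊆ S)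
    (hB : IsC1Submanifold (projEmb '' B)) : IsC1Submanifold (projEmb '' (Ψ t ⁻¹' B)) := by
  obtain ⟨H, -, hHΨ, hdiff⟩ := (hΨ S hS).exists_diffeo
  obtain ⟨G, hG⟩ := hdiff t ht
  rw [hΨ.image_preimage h𝒮 ht hS hBS hHΨ]
  exact (h𝒮.stratum_submanifold S hS).preimage_diffeo hB (image_mono hBS) hG

/-- The set of all `(t, x)` such that `Ψ t` maps `x` into `B`. -/
def preimageFamily (U : Set (Fin m → 𝕜)) (Ψ : (Fin m → 𝕜) → ProjSpace 𝕜 n → ProjSpace 𝕜 n)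
    (B : Set (ProjSpace 𝕜 n)) : Set ((Fin m → 𝕜) × MatSpace 𝕜 n) :=
  {z | z.1 ∈ U ∧ z.2 ∈ projEmb '' (Ψ z.1 ⁻¹' B)}

theorem isSemialgebraic_preimageFamily (hΨ : IsSemialgebraicFamily U Ψ)
    (hB : IsSemialgebraic (projEmb '' B)) : IsSemialgebraic (preimageFamily U Ψ B) := by
  have i := isPolyMap_id (E := ((Fin m → 𝕜) × MatSpace 𝕜 n) × MatSpace 𝕜 n)
  have h1 := ((hΨ.preimage (i.fst.fst.prodMk (i.fst.snd.prodMk i.snd))).inter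
    (hB.preimage i.snd)).exists
  convert h1 using 1
  ext ⟨t, z⟩
  constructor
  · rintro ⟨ht, x, hx, rfl⟩
    exact ⟨projEmb (Ψ t x), ⟨ht, x, rfl, rfl⟩, mem_image_of_mem _ hx⟩
  · rintro ⟨y, ⟨ht, x, hx, hy⟩, hyB⟩
    simp only at hx hy ht hyB
    rw [mem_preimage, hy, projEmb_injective.mem_set_image] at hyB
    exact ⟨ht, x, hyB, hx.symm⟩

theorem isSemialgebraic_image_preimage (hΨ : IsSemialgebraicFamily U Ψ)
    (hB : IsSemialgebraic (projEmb '' B)) (ht : t ∈ U) :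
    IsSemialgebraic (projEmb '' (Ψ t ⁻¹' B)) := by
  convert (isSemialgebraic_preimageFamily hΨ hB).preimage
    ((isPolyMap_const t).prodMk (isPolyMap_id (E := MatSpace 𝕜 n))) using 1
  ext z
  exact ⟨fun h => ⟨ht, h⟩, fun h => h.2⟩

theorem IsSubstratified.preimage (h𝒮 : IsStratification 𝒮 univ)
    (hΨs : IsSemialgebraicFamily U Ψ) (hΨ : IsStratifiedSubmersiveFamily U 𝒮 Ψ)
    {W : Set (ProjSpace 𝕜 n)} {ℬ : Set (Set (ProjSpace 𝕜 n))}
    (hℬ : IsSubstratified univ 𝒮 W ℬ) (ht : t ∈ U) :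
    IsSubstratified univ 𝒮 (Ψ t ⁻¹' W) ((fun B => Ψ t ⁻¹' B) '' ℬ) where
  subset := subset_univ _
  stratification :=
    { semialgebraic := isSemialgebraic_image_preimage hΨs hℬ.stratification.semialgebraic ht
      nonempty := by
        rintro _ ⟨B, hB, rfl⟩
        obtain ⟨y, hy⟩ := hℬ.stratification.nonempty B hB
        obtain ⟨S, hS, hBS⟩ := hℬ.exists_stratum B hB
        obtain ⟨x, -, hx⟩ := ((hΨ S hS).bijOn t ht).surjOn (hBS hy)
        exact ⟨x, by rwa [mem_preimage, hx]⟩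
      disjoint := by
        rintro _ ⟨B, hB, rfl⟩ _ ⟨B', hB', rfl⟩ hne
        exact (hℬ.stratification.disjoint hB hB' fun h => hne (by rw [h])).preimage (Ψ t)
      sUnion_eq := by
        rw [← hℬ.stratification.sUnion_eq, sUnion_image, preimage_sUnion]
      locallyFinite := by
        have : Finite ((fun B => Ψ t ⁻¹' B) '' ℬ) := hℬ.stratification.finite.image _
        exact locallyFinite_of_finite _
      stratum_semialgebraic := by
        rintro _ ⟨B, hB, rfl⟩
        exact isSemialgebraic_image_preimage hΨs
          (hℬ.stratification.stratum_semialgebraic B hB) ht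
      stratum_submanifold := by
        rintro _ ⟨B, hB, rfl⟩
        obtain ⟨S, hS, hBS⟩ := hℬ.exists_stratum B hB
        exact hΨ.isC1Submanifold_preimage h𝒮 ht hS hBS
          (hℬ.stratification.stratum_submanifold B hB) }
  exists_stratum := by
    rintro _ ⟨B, hB, rfl⟩
    obtain ⟨S, hS, hBS⟩ := hℬ.exists_stratum B hB
    exact ⟨S, hS, fun x hx => hΨ.mem_of_apply_mem h𝒮 ht hS (hBS hx)⟩

/-! ### The set of parameters without transversality -/

/-- The set of all `(t, x)` such that `A` and the preimage of `B` under `Ψ t` are not transverse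
in `S` at `x`. -/
def nontransverseSet (U : Set (Fin m → 𝕜)) (Ψ : (Fin m → 𝕜) → ProjSpace 𝕜 n → ProjSpace 𝕜 n)
    (S A B : Set (ProjSpace 𝕜 n)) : Set ((Fin m → 𝕜) × MatSpace 𝕜 n) :=
  {z | (z.2 ∈ projEmb '' A ∧ z ∈ preimageFamily U Ψ B) ∧
    ¬ ∀ w, w ∈ secantLimits (projEmb '' S) z.2 →
      ∃ u, u ∈ secantLimits (projEmb '' A) z.2 ∧
        w - u ∈ secantLimits {q | (z.1, q) ∈ preimageFamily U Ψ B} z.2}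

theorem isSemialgebraic_nontransverseSet (hΨ : IsSemialgebraicFamily U Ψ)
    {S A B : Set (ProjSpace 𝕜 n)} (hS : IsSemialgebraic (projEmb '' S))
    (hA : IsSemialgebraic (projEmb '' A)) (hB : IsSemialgebraic (projEmb '' B)) :
    IsSemialgebraic (nontransverseSet U Ψ S A B) := by
  have hD := isSemialgebraic_preimageFamily hΨ hB
  have i := isPolyMap_id (E := (Fin m → 𝕜) × MatSpace 𝕜 n)
  have j := isPolyMap_id (E := ((Fin m → 𝕜) × MatSpace 𝕜 n) × MatSpace 𝕜 n)
  have k := isPolyMap_id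
    (E := (((Fin m → 𝕜) × MatSpace 𝕜 n) × MatSpace 𝕜 n) × MatSpace 𝕜 n)
  have hconst : ∀ {C : Set (ProjSpace 𝕜 n)}, IsSemialgebraic (projEmb '' C) →
      IsSemialgebraic {z : (Fin m → 𝕜) × MatSpace 𝕜 n × MatSpace 𝕜 n |
        z.2.2 ∈ secantLimits (projEmb '' C) z.2.1} := fun {C} hC =>
    isSemialgebraic_secantLimits
      (hC.preimage (isPolyMap_id (E := (Fin m → 𝕜) × MatSpace 𝕜 n)).snd)
  have h1 := (hconst hS).preimage (j.fst.fst.prodMk (j.fst.snd.prodMk j.snd))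
  have h2 := (hconst hA).preimage (k.fst.fst.fst.prodMk (k.fst.fst.snd.prodMk k.snd))
  have h3 := (isSemialgebraic_secantLimits hD).preimage
    (k.fst.fst.fst.prodMk (k.fst.fst.snd.prodMk (k.fst.snd.sub k.snd)))
  exact ((hA.preimage i.snd).inter hD).and (h1.imp (h2.inter h3).exists).forall.not

theorem setOf_mem_preimageFamily (ht : t ∈ U) :
    {q | (t, q) ∈ preimageFamily U Ψ B} = projEmb '' (Ψ t ⁻¹' B) := by
  ext q
  exact ⟨fun h => h.2, fun h => ⟨ht, h⟩⟩

variable {A : Set (ProjSpace 𝕜 n)}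

theorem transverseIn_of_notMem (h𝒮 : IsStratification 𝒮 univ)
    (hΨ : IsStratifiedSubmersiveFamily U 𝒮 Ψ) (hS : S ∈ 𝒮) (hAS : A ⊆ S) (hBS : B ⊆ S)
    (hA : IsC1Submanifold (projEmb '' A)) (hB : IsC1Submanifold (projEmb '' B)) (ht : t ∈ U)
    (h : ∀ z, (t, z) ∉ nontransverseSet U Ψ S A B) : TransverseIn S A (Ψ t ⁻¹' B) := by
  rintro x ⟨hxA, hxB⟩
  have hC := hΨ.isC1Submanifold_preimage h𝒮 ht hS hBS hB
  have hS' := h𝒮.stratum_submanifold S hS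
  have hxS := mem_image_of_mem projEmb (hAS hxA)
  have hCS : Ψ t ⁻¹' B ⊆ S := fun y hy => hΨ.mem_of_apply_mem h𝒮 ht hS (hBS hy)
  refine Subset.antisymm ?_ fun w hw => ?_
  · rintro _ ⟨u, hu, v, hv, rfl⟩
    exact hS'.add_mem_tangentVectors hxS (tangentVectors_mono (image_mono hAS) _ hu)
      (tangentVectors_mono (image_mono hCS) _ hv)
  · have hmem : (projEmb x ∈ projEmb '' A ∧ (t, projEmb x) ∈ preimageFamily U Ψ B) :=
      ⟨mem_image_of_mem _ hxA, ht, mem_image_of_mem _ hxB⟩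
    have h1 := not_not.1 fun h' => h (projEmb x) ⟨hmem, h'⟩
    simp only [setOf_mem_preimageFamily ht, ← tangentVectors_eq_secantLimits hS' hxS,
      ← tangentVectors_eq_secantLimits hA (mem_image_of_mem _ hxA),
      ← tangentVectors_eq_secantLimits hC (mem_image_of_mem _ hxB)] at h1
    obtain ⟨u, hu, hv⟩ := h1 w hw
    exact ⟨u, hu, w - u, hv, add_sub_cancel u w⟩

/-- An open set of bad parameters would carry a differentiable section of bad points over a smaller
open set. Differentiating its membership in `A` and in the preimages of `B` yields transversality at
one of these points. -/
theorem interior_proj_nontransverseSet (h𝒮 : IsStratification 𝒮 univ) (hU : IsOpen U)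
    (hΨs : IsSemialgebraicFamily U Ψ) (hΨ : IsStratifiedSubmersiveFamily U 𝒮 Ψ)
    (hS : S ∈ 𝒮) (hAS : A ⊆ S) (hBS : B ⊆ S)
    (hA : IsC1Submanifold (projEmb '' A)) (hB : IsC1Submanifold (projEmb '' B))
    (hAs : IsSemialgebraic (projEmb '' A)) (hBs : IsSemialgebraic (projEmb '' B)) :
    interior {t | ∃ z, (t, z) ∈ nontransverseSet U Ψ S A B} = ∅ := by
  by_contra hne
  obtain ⟨V, hV, hVo, ⟨t₀, ht₀⟩, σ, hσ, hσK⟩ := exists_differentiable_section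
    (isSemialgebraic_nontransverseSet hΨs (h𝒮.stratum_semialgebraic S hS) hAs hBs)
    isOpen_interior (nonempty_iff_ne_empty.2 hne)
    fun t ht => (interior_subset ht : t ∈ {t | ∃ z, (t, z) ∈ nontransverseSet U Ψ S A B})
  obtain ⟨H, hH, hHΨ, hdiff⟩ := (hΨ S hS).exists_diffeo
  obtain ⟨⟨hσA, ht₀U, hσB⟩, hnot⟩ := hσK t₀ ht₀
  obtain ⟨G, hG⟩ := hdiff t₀ ht₀U
  have hS' := h𝒮.stratum_submanifold S hS
  have hC := hΨ.isC1Submanifold_preimage h𝒮 ht₀U hS hBS hB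
  have hσS := image_mono (f := projEmb) hAS hσA
  refine hnot ?_
  simp only at hσA hσB hσS ⊢
  rw [setOf_mem_preimageFamily ht₀U, ← tangentVectors_eq_secantLimits hS' hσS,
    ← tangentVectors_eq_secantLimits hA hσA, ← tangentVectors_eq_secantLimits hC hσB,
    hΨ.image_preimage h𝒮 ht₀U hS hBS hHΨ]
  intro w hw
  have hVn : V ∈ 𝓝 t₀ := hVo.mem_nhds ht₀
  obtain ⟨u, hu, v, hv, rfl⟩ := exists_add_eq_of_section hS' (image_mono hAS) (image_mono hBS)
    (hU.mem_nhds ht₀U) hH hG (hσ.differentiableAt hVn)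
    (mem_of_superset hVn fun t ht => (hσK t ht).1.1)
    (mem_of_superset hVn fun t ht => by
      have h1 := hσK t ht
      have h2 := h1.1.2.2
      rw [hΨ.image_preimage h𝒮 h1.1.2.1 hS hBS hHΨ] at h2
      exact h2.2) (by
      obtain ⟨x, hx, hxσ⟩ := hσS
      rw [← hxσ, hHΨ t₀ ht₀U x hx]
      have h1 := (hΨ S hS).submersive t₀ ht₀U x hx
      have h2 : (fun t => H (t, projEmb x)) =ᶠ[𝓝 t₀] fun s => projEmb (Ψ s x) :=
        mem_of_superset (hU.mem_nhds ht₀U) fun t ht => hHΨ t ht x hx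
      rw [h2.fderiv_eq, h1]
      exact Subset.rfl) hw
  exact ⟨u, hu, by rwa [add_sub_cancel_left]⟩

end Strata

/-! ### The open dense set of transverse parameters. -/

theorem mainTheorem2 {𝕜 : Type*} [RCLike 𝕜] (n : ℕ)
    (𝒮 : Set (Set (ProjSpace 𝕜 n))) (h𝒮 : IsStratification 𝒮 univ)
    (U : Set (Fin (n + 1) → 𝕜)) (hUo : IsOpen U) (hUs : IsSemialgebraic U)
    (Ψ : (Fin (n + 1) → 𝕜) → ProjSpace 𝕜 n → ProjSpace 𝕜 n)
    (hΨs : IsSemialgebraicFamily U Ψ)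
    (hΨ : IsStratifiedSubmersiveFamily U 𝒮 Ψ)
    (Z W : Set (ProjSpace 𝕜 n)) (𝒜 ℬ : Set (Set (ProjSpace 𝕜 n)))
    (h𝒜 : IsSubstratified univ 𝒮 Z 𝒜) (hℬ : IsSubstratified univ 𝒮 W ℬ) :
    ∃ U' : Set (Fin (n + 1) → 𝕜), U' ⊆ U ∧ IsOpen U' ∧ U ⊆ closure U' ∧ IsSemialgebraic U' ∧
      ∀ t ∈ U', StratifiedTransverse univ 𝒮 Z 𝒜
        (Ψ t ⁻¹' W) ((fun B => Ψ t ⁻¹' B) '' ℬ) := by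
  have hq : ∀ i : Set (ProjSpace 𝕜 n) × Set (ProjSpace 𝕜 n) × Set (ProjSpace 𝕜 n),
      i ∈ {i ∈ 𝒮 ×ˢ 𝒜 ×ˢ ℬ | i.2.1 ⊆ i.1 ∧ i.2.2 ⊆ i.1} →
      ∃ q ∈ realPolyFunctions (Fin (n + 1) → 𝕜), q ≠ 0 ∧
        ∀ t z, (t, z) ∈ nontransverseSet U Ψ i.1 i.2.1 i.2.2 → q t = 0 := by
    rintro ⟨S, A, B⟩ ⟨⟨hS, hA, hB⟩, hAS, hBS⟩
    have hAs := h𝒜.stratification.stratum_semialgebraic A hA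
    have hBs := hℬ.stratification.stratum_semialgebraic B hB
    have hi := interior_proj_nontransverseSet h𝒮 hUo hΨs hΨ hS hAS hBS
      (h𝒜.stratification.stratum_submanifold A hA) (hℬ.stratification.stratum_submanifold B hB)
      hAs hBs
    obtain ⟨q, hq, hq0, h⟩ := (isSemialgebraic_nontransverseSet hΨs
      (h𝒮.stratum_semialgebraic S hS) hAs hBs).exists.exists_poly_of_notMem_interior
    exact ⟨q, hq, hq0, fun t z hz => h t ⟨z, hz⟩ (by rw [hi]; exact notMem_empty t)⟩
  choose! q hqp hq0 hqz using hq
  have hfin : {i ∈ 𝒮 ×ˢ 𝒜 ×ˢ ℬ | i.2.1 ⊆ i.1 ∧ i.2.2 ⊆ i.1}.Finite :=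
    (h𝒮.finite.prod (h𝒜.stratification.finite.prod hℬ.stratification.finite)).subset
      (sep_subset _ _)
  -- One nonzero polynomial vanishes at the bad parameters of every triple. The complement of its
  -- zeros is open, dense and semialgebraic, so intersecting it with `U` gives the required set.
  obtain ⟨Q, hQ, hQ0, hQz⟩ := exists_poly_of_finite (hfin.image q)
    (by rintro _ ⟨i, hi, rfl⟩; exact hqp i hi) (by rintro _ ⟨i, hi, rfl⟩; exact hq0 i hi)
  refine ⟨U ∩ {t | Q t ≠ 0}, inter_subset_left, hUo.inter (isOpen_ne_fun
    (continuous_of_mem_realPolyFunctions hQ) continuous_const),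
    (dense_ne_zero_of_mem_realPolyFunctions hQ hQ0).open_subset_closure_inter hUo,
    hUs.inter (isSemialgebraic_eq_zero (isPolyMap_real.2 hQ)).not, ?_⟩
  rintro t ⟨htU, htQ⟩
  refine ⟨h𝒜, hℬ.preimage h𝒮 hΨs hΨ htU, ?_⟩
  rintro S hS A hA _ ⟨B, hB, rfl⟩ hAS hBS'
  -- Only the preimage of `B` is given to lie in `S`. Its points also lie in the stratum containing
  -- `B`, so the two strata coincide by disjointness.
  have hBS : B ⊆ S := by
    obtain ⟨S', hS', hBS⟩ := hℬ.exists_stratum B hB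
    obtain ⟨y, hy⟩ := hℬ.stratification.nonempty B hB
    obtain ⟨x, hx, rfl⟩ := ((hΨ S' hS').bijOn t htU).surjOn (hBS hy)
    rwa [h𝒮.disjoint.elim_set hS hS' x (hBS' hy) hx]
  refine transverseIn_of_notMem h𝒮 hΨ hS hAS hBS
    (h𝒜.stratification.stratum_submanifold A hA)
    (hℬ.stratification.stratum_submanifold B hB) htU fun z hz => htQ ?_
  exact hQz _ ⟨(S, A, B), ⟨⟨hS, hA, hB⟩, hAS, hBS⟩, rfl⟩ t
    (hqz (S, A, B) ⟨⟨hS, hA, hB⟩, hAS, hBS⟩ t z hz)
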